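/- For a subset $K$ and a subset $B$ of a normed space, let $M(K,B)\in\{0,1,2,\dots\}\cup\{\infty\}$ be the packing number, i.e. the supremum of the cardinalities of sets $S\subset K$ such that the interiors of the translates $x+B$, $x\in S$, are pairwise disjoint. Logarithms are to the base $2$, with $\log\infty=\infty$. For a real normed space $X$ with dual $X^*$ and a set $A\subset X$, let $A^\circ=\{u\in X^*:\sup_{x\in A}u(x)\le 1\}$. The $K$-convexity constant $K(X)\in[0,\infty]$ of $X$ is the supremum over $n$ of the operator norms, on $L_2(\{-1,1\}^n;X)$ with the uniform probability measure, of the Rademacher projections $f\mapsto\sum_{i=1}^n r_i\,\mathbb E[r_i f]$, where $r_i(\omega)=\omega_i$; the space $X$ is $K$-convex if $K(X)<\infty$. **Theorem.** For every $\kappa\in[0,\infty)$ there are $a,b\ge 1$, depending only on $\kappa$, such that the following holds. Let $X$ be a real normed space (of finite or infinite dimension) which is $K$-convex with $K(X)\le\kappa$, and let $B$ be its closed unit ball. Then for every nonempty convex set $T\subset X$ that is symmetric ($T=-T$) and every $\varepsilon>0$, $$b^{-1}\log M(B^\circ,a\varepsilon T^\circ)\ \le\ \log M(T,\varepsilon B)\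 \le\ b\,\log M(B^\circ,a^{-1}\varepsilon T^\circ).$$ -/

import Mathlib

open scoped NNReal ENNReal Pointwise

noncomputable section

/-- The packing number `M(K, B)`, an extended natural number: the supremum of the numbers of
translates of `B` by (distinct) elements of `K` whose interiors are pairwise disjoint. -/
def packingNumber {E : Type*} [AddCommGroup E] [TopologicalSpace E] (K B : Set E) : ℕ∞ :=
  ⨆ (S : Set E) (_ : S ⊆ K) (_ : S.PairwiseDisjoint (fun x => interior (x +ᵥ B))), S.encard

/-- The logarithm to the base 2, with `log 0 = -∞` and `log ∞ = ∞`. -/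
def logTwo (N : ℕ∞) : EReal :=
  ENNReal.log (N : ℝ≥0∞) / ((Real.log 2 : ℝ) : EReal)

/-- The `i`-th Rademacher function on the cube `{-1, 1}ⁿ`, i.e. the `i`-th coordinate. -/
def rademacher {n : ℕ} (i : Fin n) (ω : Fin n → ℤˣ) : ℝ := ((ω i : ℤ) : ℝ)

/-- The average of a function over the cube `{-1, 1}ⁿ` (the integral for the uniform
probability measure). -/
def cubeMean {n : ℕ} {X : Type*} [AddCommGroup X] [Module ℝ X] (f : (Fin n → ℤˣ) → X) : X :=
  ((2 : ℝ) ^ n)⁻¹ • ∑ ω, f ω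

/-- The norm of `L₂({-1, 1}ⁿ; X)`. -/
def cubeL2Norm {n : ℕ} {X : Type*} [NormedAddCommGroup X] (f : (Fin n → ℤˣ) → X) : ℝ :=
  Real.sqrt (cubeMean fun ω => ‖f ω‖ ^ 2)

/-- The (vector valued) Rademacher projection, `f ↦ ∑ i, r_i 𝔼[r_i f]`. -/
def rademacherProj {n : ℕ} {X : Type*} [AddCommGroup X] [Module ℝ X]
    (f : (Fin n → ℤˣ) → X) : (Fin n → ℤˣ) → X :=
  fun ω => ∑ i, rademacher i ω • cubeMean (fun ω' => rademacher i ω' • f ω')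

/-- The K-convexity constant `K(X) ∈ [0, ∞]`: the supremum over `n` of the norms of the Rademacher
projections on `L₂({-1, 1}ⁿ; X)`, i.e. the least common bound of these operators.
The space `X` is K-convex when it is finite. -/
def kConvexityConst (X : Type*) [NormedAddCommGroup X] [NormedSpace ℝ X] : ℝ≥0∞ :=
  ⨅ (C : ℝ≥0) (_ : ∀ (n : ℕ) (f : (Fin n → ℤˣ) → X),
    cubeL2Norm (rademacherProj f) ≤ C * cubeL2Norm f), (C : ℝ≥0∞)

end

/-! Entropy duality by convexly separated sequences. Packing by disjoint interiors is replaced by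
the separation number `sepNum`, at the cost of a factor 2 in the scale.

Suppose first that `K` lies in a ball of radius `R * s` and test it at scale `s` against the dual
ball `L`. Take a longest sequence in `K` whose every term is cut off from the hull of its
predecessors by a functional in `L`. After pigeonholing the value of each functional at its own
point, these functionals are separated with respect to `K`, so the length `N` is at most `q` times
the dual separation number. By maximality and minimax, every point of `K` is near the hull of the
`N` points; by Maurey's method it is near an average of `m` of them, with `m` fixed. Hence the
separation number of `K` is at most `(N + 1) ^ m`, a bounded power of the dual one
(`sepNum_le_sepNum_flip_pow`). The argument applies to either side of the pairing.

K-convexity enters only through Maurey's method, for the space and for its dual. If all signed sums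
of some `2 ^ n` unit-ball vectors were almost maximal, these vectors would span `ℓ_1` with constant
2, and there the Rademacher projection has norm of order `√n` from `L_∞` to `L_1`. So for a suitable
`n` some signed sum gains a factor `θ < 1`; the gain multiplies over blocks, and repeated halving of
long averages then has summable errors.

For general bounded `T`, truncate at radius `512 * s`. The number at scale `s` is at most the
truncated number times the number at a coarser scale, while conversely the product of a truncated
and a coarse number is bounded by a fine number. The induction hypothesis carries a product of two
dual numbers, arranged so that the factors telescope; the exponent therefore does not grow with the
number of scales. For unbounded `T` both sides are infinite. -/

/-- The supremum of the cardinalities of finite subsets of `K`, no two of whose points differ by an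
element of `D`. -/
noncomputable def sepNum {E : Type*} [AddCommGroup E] (K D : Set E) : ℕ∞ :=
  ⨆ (S : Finset E) (_ : (S : Set E) ⊆ K) (_ : ∀ x ∈ S, ∀ y ∈ S, x ≠ y → x - y ∉ D), (S.card : ℕ∞)

/-! ### Separation numbers -/

section sepNum

variable {E : Type*} [AddCommGroup E] {K K' D D' : Set E}

theorem card_le_sepNum {S : Finset E} (hK : ∀ x ∈ S, x ∈ K)
    (hD : ∀ x ∈ S, ∀ y ∈ S, x ≠ y → x - y ∉ D) : (S.card : ℕ∞) ≤ sepNum K D :=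
  le_iSup_of_le S (le_iSup_of_le hK (le_iSup_of_le hD le_rfl))

theorem sepNum_le {N : ℕ∞} (h : ∀ S : Finset E, (∀ x ∈ S, x ∈ K) →
    (∀ x ∈ S, ∀ y ∈ S, x ≠ y → x - y ∉ D) → (S.card : ℕ∞) ≤ N) : sepNum K D ≤ N :=
  iSup_le fun S => iSup_le fun h1 => iSup_le fun h2 => h S h1 h2

theorem card_le_sepNum_of_family {ι : Type*} {I : Finset ι} {f : ι → E} (h0 : (0 : E) ∈ D)
    (hK : ∀ i ∈ I, f i ∈ K) (hD : ∀ i ∈ I, ∀ j ∈ I, i ≠ j → f i - f j ∉ D) :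
    (I.card : ℕ∞) ≤ sepNum K D := by
  classical
  have hinj : Set.InjOn f I := by
    intro i hi j hj hij
    by_contra hne
    exact hD i hi j hj hne (by simpa [hij] using h0)
  rw [← Finset.card_image_of_injOn hinj]
  apply card_le_sepNum
  · intro x hx
    obtain ⟨i, hi, rfl⟩ := Finset.mem_image.1 hx
    exact hK i hi
  · intro x hx y hy hxy
    obtain ⟨i, hi, rfl⟩ := Finset.mem_image.1 hx
    obtain ⟨j, hj, rfl⟩ := Finset.mem_image.1 hy
    exact hD i hi j hj (fun h => hxy (by rw [h]))

/-- A map which reflects separation does not decrease the separation number. -/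
theorem sepNum_le_of_map {F : Type*} [AddCommGroup F] {L C : Set F} (φ : E → F) (h0 : (0 : F) ∈ C)
    (hK : ∀ x ∈ K, φ x ∈ L) (hD : ∀ x ∈ K, ∀ y ∈ K, φ x - φ y ∈ C → x - y ∈ D) :
    sepNum K D ≤ sepNum L C :=
  sepNum_le fun _ h1 h2 => card_le_sepNum_of_family (f := φ) h0 (fun i hi => hK i (h1 i hi))
    fun i hi j hj hij h => h2 i hi j hj hij (hD i (h1 i hi) j (h1 j hj) h)

theorem sepNum_mono (h0 : (0 : E) ∈ D') (hK : K ⊆ K') (hD : D' ⊆ D) :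
    sepNum K D ≤ sepNum K' D' :=
  sepNum_le_of_map id h0 hK fun _ _ _ _ h => hD h

theorem one_le_sepNum (hK : K.Nonempty) : 1 ≤ sepNum K D := by
  obtain ⟨x, hx⟩ := hK
  have := card_le_sepNum (S := {x}) (K := K) (D := D) (by simpa using hx) (by
    intro a ha b hb hab
    simp at ha hb
    exact absurd (ha.trans hb.symm) hab)
  simpa using this

theorem two_le_sepNum (h0 : (0 : E) ∈ D) {x y : E} (hx : x ∈ K) (hy : y ∈ K) (hxy : x - y ∉ D)
    (hyx : y - x ∉ D) : 2 ≤ sepNum K D := by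
  have := card_le_sepNum_of_family (I := (Finset.univ : Finset Bool)) (K := K) (D := D)
    (f := fun b => if b then x else y) h0 (by intro i _; cases i <;> simp [hx, hy])
    (by intro i _ j _ hij; cases i <;> cases j <;> simp_all)
  simpa using this

theorem sepNum_le_one (h : ∀ x ∈ K, ∀ y ∈ K, x - y ∈ D) : sepNum K D ≤ 1 := by
  refine sepNum_le fun S h1 h2 => ?_
  have : S.card ≤ 1 := by
    rw [Finset.card_le_one]
    intro a ha b hb
    by_contra hne
    exact h2 a ha b hb hne (h a (h1 a ha) b (h1 b hb))
  exact_mod_cast this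

/-- Splitting a separated set along a coarser scale. -/
theorem sepNum_le_mul (h0 : (0 : E) ∈ D) (h0' : (0 : E) ∈ D') (hD' : ∀ x ∈ D', -x ∈ D') :
    sepNum K D ≤ sepNum K D' * sepNum ((K - K) ∩ D') D := by
  classical
  refine sepNum_le fun S h1 h2 => ?_
  -- A maximal `D'`-separated subset is a `D'`-net of `S`. Each point is assigned to a nearby net
  -- point, and each fibre is translated to the origin.
  obtain ⟨S', hS'⟩ := (S.powerset.filter
    (fun S' => ∀ x ∈ S', ∀ y ∈ S', x ≠ y → x - y ∉ D')).exists_maximal ⟨∅, by simp⟩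
  have hmem := hS'.prop
  simp only [Finset.mem_filter, Finset.mem_powerset] at hmem
  have hnear : ∀ x ∈ S, ∃ y ∈ S', x - y ∈ D' := by
    intro x hx
    by_contra! hcon
    have hxS' : x ∉ S' := fun hx' => hcon x hx' (by simpa using h0')
    have hins : insert x S' ∈ S.powerset.filter
        (fun S' => ∀ x ∈ S', ∀ y ∈ S', x ≠ y → x - y ∉ D') := by
      simp only [Finset.mem_filter, Finset.mem_powerset]
      refine ⟨Finset.insert_subset hx hmem.1, ?_⟩
      intro a ha b hb hab
      rw [Finset.mem_insert] at ha hb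
      rcases ha with rfl | ha <;> rcases hb with rfl | hb
      · exact absurd rfl hab
      · exact hcon b hb
      · intro h
        exact hcon a ha (by simpa using hD' _ h)
      · exact hmem.2 a ha b hb hab
    exact hxS' (hS'.le_of_ge hins (Finset.subset_insert x S') (Finset.mem_insert_self x S'))
  choose! π hπ hπD using hnear
  have hfib : ∀ y ∈ S', (((S.filter (fun x => π x = y)).card : ℕ) : ℕ∞) ≤
      sepNum ((K - K) ∩ D') D := by
    intro y hy
    refine card_le_sepNum_of_family (f := fun x => x - y) h0 ?_ ?_
    · intro x hx
      rw [Finset.mem_filter] at hx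
      refine ⟨Set.sub_mem_sub (h1 x hx.1) (h1 y (hmem.1 hy)), ?_⟩
      have := hπD x hx.1
      rwa [hx.2] at this
    · intro a ha b hb hab
      rw [Finset.mem_filter] at ha hb
      simpa using h2 a ha.1 b hb.1 hab
  calc (S.card : ℕ∞) = ∑ y ∈ S', (((S.filter (fun x => π x = y)).card : ℕ) : ℕ∞) := by
        rw [Finset.card_eq_sum_card_fiberwise (fun x hx => hπ x hx)]
        push_cast; rfl
    _ ≤ ∑ y ∈ S', sepNum ((K - K) ∩ D') D := Finset.sum_le_sum hfib
    _ = (S'.card : ℕ∞) * sepNum ((K - K) ∩ D') D := by simp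
    _ ≤ _ := by
        gcongr
        exact card_le_sepNum (fun x hx => h1 x (hmem.1 hx)) hmem.2

/-- Combining two separated sets to one. -/
theorem mul_sepNum_le {F G : Type*} [AddCommGroup F] [AddCommGroup G] {L C : Set F} {M A : Set G}
    (φ : E → F → G) (h0 : (0 : G) ∈ A) (hM : ∀ x ∈ K, ∀ y ∈ L, φ x y ∈ M)
    (h : ∀ x ∈ K, ∀ x' ∈ K, ∀ y ∈ L, ∀ y' ∈ L, (x = x' ∨ x - x' ∉ D) → (y = y' ∨ y - y' ∉ C) →
      φ x y - φ x' y' ∈ A → x = x' ∧ y = y') :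
    sepNum K D * sepNum L C ≤ sepNum M A := by
  classical
  have key : ∀ S : Finset E, (∀ x ∈ S, x ∈ K) → (∀ x ∈ S, ∀ y ∈ S, x ≠ y → x - y ∉ D) →
      ∀ S' : Finset F, (∀ x ∈ S', x ∈ L) → (∀ x ∈ S', ∀ y ∈ S', x ≠ y → x - y ∉ C) →
      (S.card : ℕ∞) * S'.card ≤ sepNum M A := by
    intro S h1 h2 S' h1' h2'
    have := card_le_sepNum_of_family (I := S ×ˢ S') (f := fun q : E × F => φ q.1 q.2) (K := M) h0
      (by
        intro q hq
        rw [Finset.mem_product] at hq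
        exact hM _ (h1 _ hq.1) _ (h1' _ hq.2))
      (by
        intro q hq q' hq' hne hA
        rw [Finset.mem_product] at hq hq'
        obtain ⟨e1, e2⟩ := h _ (h1 _ hq.1) _ (h1 _ hq'.1) _ (h1' _ hq.2) _ (h1' _ hq'.2)
          (by by_cases e : q.1 = q'.1
              · exact Or.inl e
              · exact Or.inr (h2 _ hq.1 _ hq'.1 e))
          (by by_cases e : q.2 = q'.2
              · exact Or.inl e
              · exact Or.inr (h2' _ hq.2 _ hq'.2 e)) hA
        exact hne (Prod.ext e1 e2))
    simpa [Finset.card_product] using this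
  unfold sepNum
  simp only [ENat.iSup_mul, ENat.mul_iSup]
  exact iSup_le fun S' => iSup_le fun h1' => iSup_le fun h2' => iSup_le fun S => iSup_le fun h1 =>
    iSup_le fun h2 => key S h1 h2 S' h1' h2'

end sepNum

/-- The vectors `e` with `β e l ≤ r` for all `l ∈ L`. -/
def polarAt {E F : Type*} [AddCommGroup E] [Module ℝ E] [AddCommGroup F] [Module ℝ F]
    (β : E →ₗ[ℝ] F →ₗ[ℝ] ℝ) (L : Set F) (r : ℝ) : Set E :=
  {e | ∀ l ∈ L, β e l ≤ r}

/-! ### Polars and minimax for a bilinear pairing -/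

section pairing

variable {E F : Type*} [AddCommGroup E] [Module ℝ E] [AddCommGroup F] [Module ℝ F]
  {β : E →ₗ[ℝ] F →ₗ[ℝ] ℝ} {K : Set E} {L : Set F}

theorem zero_mem_polarAt {r : ℝ} (hr : 0 ≤ r) : (0 : E) ∈ polarAt β L r := by
  intro l _
  simpa using hr

theorem neg_mem_polarAt {r : ℝ} (hL : ∀ l ∈ L, -l ∈ L) {e : E} (he : e ∈ polarAt β L r) :
    -e ∈ polarAt β L r := by
  intro l hl
  simpa using he (-l) (hL l hl)

/-- Minimax: if no `l ∈ L` separates `e` from all the points `k i`, then a convex combination of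
these points is close to `e`. -/
theorem exists_convexComb_of_not_separated {N : ℕ} (hLc : Convex ℝ L) (hLne : L.Nonempty) {r : ℝ}
    (k : Fin N → E) (e : E) (h : ∀ l ∈ L, ∃ i, β (e - k i) l < r) :
    ∃ w : Fin N → ℝ, (∀ i, 0 ≤ w i) ∧ ∑ i, w i = 1 ∧ e - ∑ i, w i • k i ∈ polarAt β L r := by
  classical
  -- The values on `L` form a convex set missing the open orthant `(r, ∞)^N`. The normal of a
  -- separating hyperplane, negated and normalised, supplies the weights.
  set O : Set (Fin N → ℝ) := Set.univ.pi fun _ => Set.Ioi r with hO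
  have hOo : IsOpen O := isOpen_set_pi Set.finite_univ fun _ _ => isOpen_Ioi
  have hOc : Convex ℝ O := convex_pi fun _ _ => convex_Ioi r
  set Φ : F →ₗ[ℝ] (Fin N → ℝ) := LinearMap.pi fun i => β (e - k i) with hΦ
  have hCc : Convex ℝ (Φ '' L) := hLc.linear_image Φ
  have hdis : Disjoint O (Φ '' L) := by
    rw [Set.disjoint_left]
    rintro v hv ⟨l, hl, rfl⟩
    obtain ⟨i, hi⟩ := h l hl
    have := hv i (Set.mem_univ i)
    simp only [hΦ, LinearMap.pi_apply, Set.mem_Ioi] at this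
    linarith
  obtain ⟨f, u, hfO, hfC⟩ := geometric_hahn_banach_open hOc hOo hCc hdis
  set a : Fin N → ℝ := fun i => f (Pi.single i 1) with ha
  have hf : ∀ v, f v = ∑ i, v i * a i := by
    intro v
    conv_lhs => rw [pi_eq_sum_univ' v]
    simp [ha, map_sum]
  have hconst : ∀ t, r < t → t * ∑ i, a i < u := by
    intro t ht
    have := hfO (fun _ => t) (fun i _ => ht)
    rwa [hf, ← Finset.mul_sum] at this
  have hapos : ∀ i, a i ≤ 0 := by
    intro i
    by_contra! hpos
    obtain ⟨t, ht0, ht⟩ : ∃ t : ℝ, 0 ≤ t ∧ u ≤ (r + 1) * ∑ i, a i + t * a i := by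
      refine ⟨|u - (r + 1) * ∑ i, a i| / a i, by positivity, ?_⟩
      rw [div_mul_cancel₀ _ hpos.ne']
      linarith [le_abs_self (u - (r + 1) * ∑ i, a i)]
    have := hfO (fun j => (r + 1) + t * (Pi.single i 1 : Fin N → ℝ) j) (by
      intro j _
      simp only [Set.mem_Ioi]
      have : 0 ≤ t * (Pi.single i 1 : Fin N → ℝ) j := by
        apply mul_nonneg ht0
        by_cases hj : j = i
        · subst hj; simp
        · simp [hj]
      linarith)
    rw [hf] at this
    simp only [add_mul, Finset.sum_add_distrib, mul_assoc, ← Finset.mul_sum] at this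
    simp only [Pi.single_apply, ite_mul, one_mul, zero_mul, Finset.sum_ite_eq', Finset.mem_univ,
      if_true] at this
    linarith
  set W : ℝ := -∑ i, a i with hW
  -- If `W = 0` the normal vanishes, and the two sides of the separation give `0 < u ≤ 0`.
  have hWpos : 0 < W := by
    have h0 : 0 ≤ W := by
      rw [hW, ← Finset.sum_neg_distrib]
      exact Finset.sum_nonneg fun i _ => neg_nonneg.2 (hapos i)
    rcases h0.lt_or_eq with h1 | h1
    · exact h1
    · exfalso
      have hz : ∀ i, a i = 0 := by
        have : ∑ i, -a i = 0 := by rw [Finset.sum_neg_distrib]; linarith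
        rw [Finset.sum_eq_zero_iff_of_nonneg fun i _ => neg_nonneg.2 (hapos i)] at this
        intro i
        simpa using this i (Finset.mem_univ i)
      obtain ⟨l, hl⟩ := hLne
      have h2 := hfC _ ⟨l, hl, rfl⟩
      have h3 := hconst (r + 1) (by linarith)
      rw [hf] at h2
      simp [hz] at h2 h3
      linarith
  refine ⟨fun i => -a i / W, fun i => div_nonneg (neg_nonneg.2 (hapos i)) hWpos.le, ?_, ?_⟩
  · rw [← Finset.sum_div, Finset.sum_neg_distrib, div_self hWpos.ne']
  · intro l hl
    have h2 := hfC _ ⟨l, hl, rfl⟩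
    rw [hf] at h2
    have hsum : ∑ i, -a i / W = 1 := by
      rw [← Finset.sum_div, Finset.sum_neg_distrib, div_self hWpos.ne']
    have h4 : W * β (e - ∑ i, (-a i / W) • k i) l = -∑ i, Φ l i * a i := by
      have : e - ∑ i, (-a i / W) • k i = ∑ i, (-a i / W) • (e - k i) := by
        simp only [smul_sub, Finset.sum_sub_distrib]
        rw [← Finset.sum_smul, hsum, one_smul]
      rw [this, map_sum, LinearMap.sum_apply, Finset.mul_sum, ← Finset.sum_neg_distrib]
      refine Finset.sum_congr rfl fun i _ => ?_
      rw [map_smul, LinearMap.smul_apply, smul_eq_mul]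
      simp only [hΦ, LinearMap.pi_apply]
      field_simp
    have h5 : -(r * W) ≤ u := by
      refine le_of_forall_pos_le_add fun η hη => ?_
      have := hconst (r + η / W) (by linarith [div_pos hη hWpos])
      have h6 : (r + η / W) * ∑ i, a i = -(r * W) - η := by
        have : ∑ i, a i = -W := by rw [hW]; ring
        rw [this]; field_simp; ring
      linarith
    have : W * β (e - ∑ i, (-a i / W) • k i) l ≤ W * r := by rw [h4]; linarith
    exact le_of_mul_le_mul_left this hWpos

end pairing

/-! ### Convexly separated sequences and duality for a bounded pairing -/

section system

variable {E F : Type*} [AddCommGroup E] [Module ℝ E] [AddCommGroup F] [Module ℝ F]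
  {β : E →ₗ[ℝ] F →ₗ[ℝ] ℝ} {K : Set E} {L : Set F}

/-- A convexly separated sequence `k 0, …, k (N - 1)` in `K`: each term is separated from the
preceding ones by a functional `l i ∈ L`. -/
def IsConvexlySeparated (β : E →ₗ[ℝ] F →ₗ[ℝ] ℝ) (K : Set E) (L : Set F) (r : ℝ) (N : ℕ)
    (k : ℕ → E) (l : ℕ → F) : Prop :=
  ∀ i < N, k i ∈ K ∧ l i ∈ L ∧ ∀ j < i, r ≤ β (k i - k j) (l i)

/-- The functionals which separate a convexly separated sequence are themselves separated, up to
a pigeonhole argument. -/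
theorem IsConvexlySeparated.le_mul_sepNum {N : ℕ} {k : ℕ → E} {l : ℕ → F}
    (h : IsConvexlySeparated β K L (1 / 32) N k l) (hK : ∀ x ∈ K, -x ∈ K) {R : ℝ}
    (hR : ∀ x ∈ K, ∀ y ∈ L, |β x y| ≤ R) {q : ℕ} (hq : 128 * R + 2 ≤ q) :
    (N : ℕ∞) ≤ q * sepNum L (polarAt β.flip K (1 / 128)) := by
  classical
  set M := sepNum L (polarAt β.flip K (1 / 128)) with hM
  -- Within a class of equal `c`, the values `β (k i) (l i)` differ by less than `1 / 64`. Of the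
  -- gap `1 / 32` this leaves `1 / 64` for `β (k j) (l j - l i)`. There are at most `128 * R + 2`
  -- classes.
  set c : ℕ → ℤ := fun i => ⌊64 * β (k i) (l i)⌋ with hc
  have hmaps : ∀ i ∈ Finset.range N, c i ∈ Finset.Icc ⌊-(64 * R)⌋ ⌊64 * R⌋ := by
    intro i hi
    obtain ⟨hk, hl, -⟩ := h i (Finset.mem_range.1 hi)
    have := abs_le.1 (hR _ hk _ hl)
    rw [Finset.mem_Icc]
    exact ⟨Int.floor_le_floor (by linarith), Int.floor_le_floor (by linarith)⟩
  have hcard : (Finset.Icc ⌊-(64 * R)⌋ ⌊64 * R⌋).card ≤ q := by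
    rw [Int.card_Icc]
    have h1 := Int.lt_floor_add_one (-(64 * R))
    have h2 := Int.floor_le (64 * R)
    have h3 : ((⌊64 * R⌋ + 1 - ⌊-(64 * R)⌋ : ℤ) : ℝ) ≤ ((q : ℤ) : ℝ) := by
      push_cast
      linarith
    have h4 : (⌊64 * R⌋ + 1 - ⌊-(64 * R)⌋ : ℤ) ≤ (q : ℤ) := by exact_mod_cast h3
    omega
  have hsep : ∀ i < N, ∀ j < i, c i = c j → 1 / 64 < β.flip (l j - l i) (k j) := by
    intro i hi j hj hij
    obtain ⟨-, -, h1⟩ := h i hi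
    have h1 := h1 j hj
    have h2 := Int.abs_sub_lt_one_of_floor_eq_floor hij
    rw [abs_lt] at h2
    simp only [LinearMap.flip_apply, map_sub, LinearMap.sub_apply] at h1 ⊢
    linarith [h2.1, h2.2]
  have hfib : ∀ b ∈ Finset.Icc ⌊-(64 * R)⌋ ⌊64 * R⌋,
      (((Finset.range N).filter (fun i => c i = b)).card : ℕ∞) ≤ M := by
    intro b _
    refine card_le_sepNum_of_family (f := l) (zero_mem_polarAt (by norm_num)) ?_ ?_
    · intro i hi
      rw [Finset.mem_filter, Finset.mem_range] at hi
      exact (h i hi.1).2.1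
    · intro i hi j hj hij hD
      rw [Finset.mem_filter, Finset.mem_range] at hi hj
      rcases lt_or_gt_of_ne hij with hlt | hlt
      · have := hsep j hj.1 i hlt (hj.2.trans hi.2.symm)
        linarith [hD (k i) (h i hi.1).1]
      · have := hsep i hi.1 j hlt (hi.2.trans hj.2.symm)
        have hD' := neg_mem_polarAt hK hD (k j) (h j hj.1).1
        rw [neg_sub] at hD'
        linarith
  calc (N : ℕ∞) = ((Finset.range N).card : ℕ∞) := by simp
    _ = ∑ b ∈ Finset.Icc ⌊-(64 * R)⌋ ⌊64 * R⌋,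
        (((Finset.range N).filter (fun i => c i = b)).card : ℕ∞) := by
      rw [Finset.card_eq_sum_card_fiberwise hmaps]
      push_cast; rfl
    _ ≤ ∑ b ∈ Finset.Icc ⌊-(64 * R)⌋ ⌊64 * R⌋, M := Finset.sum_le_sum hfib
    _ = ((Finset.Icc ⌊-(64 * R)⌋ ⌊64 * R⌋).card : ℕ∞) * M := by simp
    _ ≤ q * M := by gcongr

/-- Every element of the convex hull of a finite family in `K` is `r`-close, in the sense of `L`,
to an average of `m` elements of the family and zeros. -/
def HasSparseApprox (β : E →ₗ[ℝ] F →ₗ[ℝ] ℝ) (K : Set E) (L : Set F) (r : ℝ) (m : ℕ) : Prop :=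
  ∀ (N : ℕ) (k : Fin N → E), (∀ i, k i ∈ K) → ∀ w : Fin N → ℝ, (∀ i, 0 ≤ w i) → ∑ i, w i = 1 →
    ∃ σ : Fin m → Option (Fin N),
      ∑ i, w i • k i - (m : ℝ)⁻¹ • ∑ j, (σ j).elim 0 k ∈ polarAt β L r

/-- A point far from the hull of the sequence would extend it, so each point has hull error `1 / 32`
plus sparsification error `1 / 32`. Two points with the same code then differ by at most `1 / 8`,
and there are `(N + 1) ^ m` codes. -/
theorem card_le_pow_of_maximal {m N : ℕ} {k : ℕ → E} {l : ℕ → F}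
    (hsp : HasSparseApprox β K L (1 / 32) m)
    (hLc : Convex ℝ L) (hLne : L.Nonempty) (hL : ∀ y ∈ L, -y ∈ L)
    (h : IsConvexlySeparated β K L (1 / 32) N k l)
    (hmax : ∀ k l, ¬ IsConvexlySeparated β K L (1 / 32) (N + 1) k l) :
    sepNum K (polarAt β L (1 / 4)) ≤ ((N + 1) ^ m : ℕ) := by
  classical
  have hnear : ∀ x ∈ K, ∃ σ : Fin m → Option (Fin N),
      x - (m : ℝ)⁻¹ • ∑ j, (σ j).elim 0 (fun i : Fin N => k i) ∈ polarAt β L (1 / 16) := by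
    intro x hx
    obtain ⟨w, hw0, hw1, hw⟩ := exists_convexComb_of_not_separated (β := β) hLc hLne
      (r := 1 / 32) (fun i : Fin N => k i) x (by
        by_contra! hcon
        obtain ⟨y, hy, hxy⟩ := hcon
        refine hmax (Function.update k N x) (Function.update l N y) fun i hi => ?_
        rcases Nat.lt_succ_iff_lt_or_eq.1 hi with hi | rfl
        · obtain ⟨h1, h2, h3⟩ := h i hi
          rw [Function.update_of_ne hi.ne, Function.update_of_ne hi.ne]
          refine ⟨h1, h2, fun j hj => ?_⟩
          rw [Function.update_of_ne (hj.trans hi).ne]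
          exact h3 j hj
        · rw [Function.update_self, Function.update_self]
          refine ⟨hx, hy, fun j hj => ?_⟩
          rw [Function.update_of_ne hj.ne]
          exact hxy ⟨j, hj⟩)
    obtain ⟨σ, hσ⟩ := hsp N (fun i => k i) (fun i => (h i i.2).1) w hw0 hw1
    refine ⟨σ, fun y hy => ?_⟩
    have h1 := hw y hy
    have h2 := hσ y hy
    simp only [map_sub, LinearMap.sub_apply] at h1 h2 ⊢
    linarith
  choose! σ hσ using hnear
  refine sepNum_le fun S h1 h2 => ?_
  have hinj : Set.InjOn σ S := by
    intro x hx y hy hxy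
    by_contra hne
    refine h2 x hx y hy hne fun z hz => ?_
    have e1 := hσ x (h1 x hx) z hz
    have e2 := hσ y (h1 y hy) (-z) (hL z hz)
    rw [hxy] at e1
    simp only [map_sub, map_neg, LinearMap.sub_apply] at e1 e2 ⊢
    linarith
  have := Finset.card_le_card_of_injOn (t := Finset.univ) σ (fun _ _ => Finset.mem_univ _) hinj
  simp only [Finset.card_univ, Fintype.card_pi, Fintype.card_option, Fintype.card_fin,
    Finset.prod_const] at this
  exact_mod_cast this

/-- Duality of separation numbers for a bounded pairing with sparse approximation. -/
theorem sepNum_le_sepNum_flip_pow {m : ℕ} (hm : m ≠ 0) (hsp : HasSparseApprox β K L (1 / 32) m)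
    (hK : ∀ x ∈ K, -x ∈ K)
    (hLc : Convex ℝ L) (hLne : L.Nonempty) (hL : ∀ y ∈ L, -y ∈ L) {R : ℝ}
    (hR : ∀ x ∈ K, ∀ y ∈ L, |β x y| ≤ R) {q : ℕ} (hq : 128 * R + 2 ≤ q) :
    sepNum K (polarAt β L (1 / 4)) ≤ sepNum L (polarAt β.flip K (1 / 128)) ^ ((q + 1) * m) := by
  classical
  have hM1 : 1 ≤ sepNum L (polarAt β.flip K (1 / 128)) := one_le_sepNum hLne
  rcases eq_or_ne (sepNum L (polarAt β.flip K (1 / 128))) ⊤ with htop | htop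
  · rw [htop, ENat.top_pow (by positivity)]
    exact le_top
  obtain ⟨M, hM⟩ := ENat.ne_top_iff_exists.1 htop
  have hbound : ∀ N k l, IsConvexlySeparated β K L (1 / 32) N k l → N ≤ q * M := by
    intro N k l h
    have := h.le_mul_sepNum hK hR hq
    rw [← hM] at this
    exact_mod_cast this
  have hzero : ∃ k l, IsConvexlySeparated β K L (1 / 32) 0 k l :=
    ⟨fun _ => 0, fun _ => 0, fun i hi => absurd hi (Nat.not_lt_zero i)⟩
  set N := Nat.findGreatest (fun N => ∃ k l, IsConvexlySeparated β K L (1 / 32) N k l) (q * M)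
  obtain ⟨k, l, hkl⟩ : ∃ k l, IsConvexlySeparated β K L (1 / 32) N k l :=
    Nat.findGreatest_spec (P := fun N => ∃ k l, IsConvexlySeparated β K L (1 / 32) N k l)
      (Nat.zero_le (q * M)) hzero
  have hmax : ∀ k l, ¬ IsConvexlySeparated β K L (1 / 32) (N + 1) k l := fun k l h =>
    Nat.findGreatest_is_greatest (Nat.lt_succ_self N) (hbound _ k l h) ⟨k, l, h⟩
  have h1 := card_le_pow_of_maximal hsp hLc hLne hL hkl hmax
  rw [← hM] at hM1 ⊢
  have hM1' : 1 ≤ M := by exact_mod_cast hM1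
  -- Powers of `M = 1` cannot absorb the factor `q`. In that case `y` and `-y` are never separated,
  -- so `K` is too small to contain two separated points.
  rcases hM1'.eq_or_lt with hM1' | hM2
  · rw [← hM1']
    simp only [Nat.cast_one, one_pow]
    refine sepNum_le_one fun x hx x' hx' y hy => ?_
    by_contra! hcon
    have hsmall : ∀ z ∈ K, β z y ≤ 1 / 8 := by
      intro z hz
      by_contra! hz8
      have h2 : 2 ≤ sepNum L (polarAt β.flip K (1 / 128)) := by
        refine two_le_sepNum (zero_mem_polarAt (by norm_num)) hy (hL y hy) ?_ ?_
        · intro h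
          have := h z hz
          simp at this
          linarith
        · intro h
          have := h (-z) (hK z hz)
          simp at this
          linarith
      rw [← hM, ← hM1'] at h2
      norm_num at h2
    have e1 := hsmall x hx
    have e2 := hsmall (-x') (hK x' hx')
    simp only [map_sub, map_neg, LinearMap.sub_apply, LinearMap.neg_apply] at e2 hcon
    linarith
  · refine h1.trans ?_
    have hN : N + 1 ≤ M ^ (q + 1) := by
      calc N + 1 ≤ q * M + 1 := by linarith [hbound _ k l hkl]
        _ ≤ (q + 1) * M := by nlinarith
        _ ≤ 2 ^ q * M := by gcongr; exact Nat.lt_two_pow_self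
        _ ≤ M ^ q * M := by gcongr; exact hM2
        _ = M ^ (q + 1) := (pow_succ M q).symm
    rw [pow_mul]
    exact_mod_cast Nat.pow_le_pow_left hN m

end system

/-! ### Sign balancing and Maurey's method -/

section balance

/-- Padding by `none`, read as the zero vector, lets averages have a prescribed number of slots. -/
theorem exists_fin_sum_eq {α ι Y : Type*} [AddCommMonoid Y] (h : α → Option ι) (A : Finset α) :
    ∀ m : ℕ, A.card ≤ m → ∃ v : Fin m → Option ι, ∀ z : ι → Y,
      ∑ j, (v j).elim 0 z = ∑ a ∈ A, (h a).elim 0 z := by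
  classical
  induction A using Finset.induction_on with
  | empty => exact fun m _ => ⟨fun _ => none, fun z => by simp⟩
  | insert a A ha ih =>
    intro m hm
    rw [Finset.card_insert_of_notMem ha] at hm
    obtain ⟨m, rfl⟩ : ∃ m', m = m' + 1 := ⟨m - 1, by omega⟩
    obtain ⟨v, hv⟩ := ih m (by omega)
    refine ⟨Fin.cons (h a) v, fun z => ?_⟩
    rw [Fin.sum_univ_succ, Finset.sum_insert ha, ← hv z]
    simp

/-- Any `P` vectors of the unit ball have a signed sum of norm at most `θ * P`. -/
def SignBalanced (Y : Type*) [NormedAddCommGroup Y] [NormedSpace ℝ Y] (P : ℕ) (θ : ℝ) : Prop :=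
  ∀ z : Fin P → Y, (∀ i, ‖z i‖ ≤ 1) → ∃ ε : Fin P → ℝ, (∀ i, ε i = 1 ∨ ε i = -1) ∧
    ‖∑ i, ε i • z i‖ ≤ θ * P

variable {Y : Type*} [NormedAddCommGroup Y] [NormedSpace ℝ Y]

theorem signBalanced_one (P : ℕ) : SignBalanced Y P 1 := fun z hz =>
  ⟨fun _ => 1, fun _ => Or.inl rfl, by
    simpa using norm_sum_le_of_le Finset.univ (fun i _ => hz i)⟩

/-- Balance inside each of `P` blocks of length `Q`, rescale the block sums to the unit ball, and
balance those. -/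
theorem SignBalanced.mul {P Q : ℕ} {θ η : ℝ} (hθ : SignBalanced Y P θ) (hη : SignBalanced Y Q η)
    (hη0 : 0 < η) : SignBalanced Y (P * Q) (θ * η) := by
  rcases Nat.eq_zero_or_pos Q with rfl | hQ
  · intro z hz
    exact ⟨fun _ => 1, fun _ => Or.inl rfl, by simp⟩
  intro z hz
  have hQ' : (0 : ℝ) < Q := by exact_mod_cast hQ
  choose ε hε hle using fun i : Fin P => hη (fun j => z (finProdFinEquiv (i, j))) fun j => hz _
  obtain ⟨δ, hδ, hδle⟩ := hθ
    (fun i => (η * Q)⁻¹ • ∑ j, ε i j • z (finProdFinEquiv (i, j))) fun i => by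
      rw [norm_smul, Real.norm_of_nonneg (by positivity), inv_mul_le_iff₀ (by positivity)]
      simpa using hle i
  refine ⟨fun k => δ (finProdFinEquiv.symm k).1 *
    ε (finProdFinEquiv.symm k).1 (finProdFinEquiv.symm k).2, fun k => ?_, ?_⟩
  · rcases hδ (finProdFinEquiv.symm k).1 with h1 | h1 <;>
      rcases hε (finProdFinEquiv.symm k).1 (finProdFinEquiv.symm k).2 with h2 | h2 <;>
      simp only [h1, h2] <;> norm_num
  · have hsum : ∑ k, (δ (finProdFinEquiv.symm k).1 *
        ε (finProdFinEquiv.symm k).1 (finProdFinEquiv.symm k).2) • z k =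
        (η * Q) • ∑ i, δ i • (η * Q)⁻¹ • ∑ j, ε i j • z (finProdFinEquiv (i, j)) := by
      rw [← Equiv.sum_comp finProdFinEquiv, Fintype.sum_prod_type, Finset.smul_sum]
      refine Finset.sum_congr rfl fun i _ => ?_
      rw [smul_comm (δ i), smul_inv_smul₀ (by positivity), Finset.smul_sum]
      refine Finset.sum_congr rfl fun j _ => ?_
      simp [mul_smul]
    rw [hsum, norm_smul, Real.norm_of_nonneg (by positivity)]
    calc η * Q * _ ≤ η * Q * (θ * P) := by gcongr
      _ = θ * η * (P * Q : ℕ) := by push_cast; ring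

theorem SignBalanced.two_pow {n : ℕ} {θ : ℝ} (h : SignBalanced Y (2 ^ n) θ) (hθ : 0 < θ) (j : ℕ) :
    SignBalanced Y (2 ^ j) (θ ^ (j / n)) := by
  have key : ∀ k, SignBalanced Y (2 ^ (n * k)) (θ ^ k) := by
    intro k
    induction k with
    | zero => simpa using signBalanced_one (Y := Y) 1
    | succ k ih =>
      rw [mul_add, mul_one, pow_add, pow_succ]
      exact ih.mul h hθ
  have := (signBalanced_one (Y := Y) (2 ^ (j % n))).mul (key (j / n)) (pow_pos hθ _)
  rwa [← pow_add, Nat.mod_add_div, one_mul] at this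

/-- Keep only the terms of sign `+1`, doubling their weight. The mean changes by the mean signed
sum, which balancing makes small. -/
theorem SignBalanced.exists_half {ι : Type*} {P : ℕ} {θ : ℝ} (hP : P ≠ 0)
    (h : SignBalanced Y (P * 2) θ)
    (z : ι → Y) (hz : ∀ i, ‖z i‖ ≤ 1) (u : Fin (P * 2) → Option ι) :
    ∃ v : Fin P → Option ι,
      ‖((P * 2 : ℕ) : ℝ)⁻¹ • ∑ j, (u j).elim 0 z - (P : ℝ)⁻¹ • ∑ j, (v j).elim 0 z‖ ≤ θ := by
  classical
  have hP' : (0 : ℝ) < P := by positivity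
  have hz' : ∀ o : Option ι, ‖o.elim 0 z‖ ≤ 1 := by
    rintro (_ | i)
    · simp
    · exact hz i
  obtain ⟨ε, hε, hle⟩ := h (fun j => (u j).elim 0 z) fun j => hz' _
  -- Reversing all signs if necessary, at most half of them are `+1`, so the kept terms fit into `P`
  -- slots.
  have key : ∃ ε : Fin (P * 2) → ℝ, (∀ i, ε i = 1 ∨ ε i = -1) ∧
      ‖∑ i, ε i • (u i).elim 0 z‖ ≤ θ * (P * 2 : ℕ) ∧
      (Finset.univ.filter (fun i => ε i = 1)).card ≤ P := by
    by_cases hc : (Finset.univ.filter (fun i => ε i = 1)).card ≤ P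
    · exact ⟨ε, hε, hle, hc⟩
    · refine ⟨-ε, fun i => ?_, ?_, ?_⟩
      · rcases hε i with h | h <;> simp [h]
      · simpa [neg_smul, Finset.sum_neg_distrib] using hle
      · have h1 := Finset.card_filter_add_card_filter_not (s := (Finset.univ : Finset (Fin (P * 2))))
          (fun i => ε i = 1)
        have h2 : (Finset.univ.filter (fun i => (-ε) i = 1)).card ≤
            (Finset.univ.filter (fun i => ¬ ε i = 1)).card := by
          refine Finset.card_le_card fun i hi => ?_
          simp only [Finset.mem_filter, Finset.mem_univ, true_and, Pi.neg_apply] at hi ⊢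
          linarith
        simp only [Finset.card_univ, Fintype.card_fin] at h1
        omega
  obtain ⟨ε, hε, hle, hcard⟩ := key
  obtain ⟨v, hv⟩ := exists_fin_sum_eq (Y := Y) u _ P hcard
  refine ⟨v, ?_⟩
  have h2 : (2 : ℝ) • ∑ j, (v j).elim 0 z =
      ∑ j, (u j).elim 0 z + ∑ j, ε j • (u j).elim 0 z := by
    rw [hv, Finset.sum_filter, Finset.smul_sum, ← Finset.sum_add_distrib]
    refine Finset.sum_congr rfl fun j _ => ?_
    rcases hε j with h | h
    · simp [h, two_smul]
    · rw [h, if_neg (by norm_num)]; simp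
  have h3 : ((P * 2 : ℕ) : ℝ)⁻¹ • ∑ j, (u j).elim 0 z - (P : ℝ)⁻¹ • ∑ j, (v j).elim 0 z =
      -(((P * 2 : ℕ) : ℝ)⁻¹ • ∑ j, ε j • (u j).elim 0 z) := by
    have : (P : ℝ)⁻¹ • ∑ j, (v j).elim 0 z =
        ((P * 2 : ℕ) : ℝ)⁻¹ • (2 : ℝ) • ∑ j, (v j).elim 0 z := by
      rw [smul_smul]; congr 1; push_cast; field_simp
    rw [this, h2, smul_add]; abel
  rw [h3, norm_neg, norm_smul, Real.norm_of_nonneg (by positivity), inv_mul_le_iff₀ (by positivity)]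
  linarith

theorem summable_pow_div {n : ℕ} (hn : 0 < n) {θ : ℝ} (hθ0 : 0 ≤ θ) (hθ1 : θ < 1) :
    Summable fun i : ℕ => θ ^ (i / n) := by
  have : NeZero n := ⟨hn.ne'⟩
  rw [← (Nat.divModEquiv n).symm.summable_iff]
  have h : Summable fun p : ℕ × Fin n => θ ^ p.1 * (1 : ℝ) :=
    (summable_geometric_of_lt_one hθ0 hθ1).mul_of_nonneg (g := fun _ : Fin n => (1 : ℝ))
      (Summable.of_finite) (fun _ => pow_nonneg hθ0 _) (fun _ => zero_le_one)
  refine h.congr fun p => ?_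
  have : (p.1 * n + p.2 : ℕ) / n = p.1 := by
    rw [mul_comm, Nat.mul_add_div hn, Nat.div_eq_of_lt p.2.2, add_zero]
  simp [Nat.divModEquiv, this]

/-- Every convex combination is approximately an average of a large number of terms. -/
theorem exists_dyadic_approx {N : ℕ} (z : Fin N → Y) (hz : ∀ i, ‖z i‖ ≤ 1) (w : Fin N → ℝ)
    (hw0 : ∀ i, 0 ≤ w i) (hw1 : ∑ i, w i = 1) (P : ℕ) (hP : P ≠ 0) :
    ∃ u : Fin P → Option (Fin N),
      ‖∑ i, w i • z i - (P : ℝ)⁻¹ • ∑ j, (u j).elim 0 z‖ ≤ N / P := by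
  classical
  have hP' : (0 : ℝ) < P := by positivity
  -- Each weight is rounded down to a multiple of `1 / P`, which costs at most `1 / P` per vector.
  set A : Finset (Σ _ : Fin N, ℕ) := Finset.univ.sigma fun i => Finset.range ⌊w i * P⌋₊ with hA
  have hcard : A.card ≤ P := by
    rw [hA, Finset.card_sigma]
    simp only [Finset.card_range]
    have : ((∑ i, ⌊w i * P⌋₊ : ℕ) : ℝ) ≤ P := by
      push_cast
      calc ∑ i, (⌊w i * P⌋₊ : ℝ) ≤ ∑ i, w i * P :=
            Finset.sum_le_sum fun i _ => Nat.floor_le (mul_nonneg (hw0 i) hP'.le)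
        _ = P := by rw [← Finset.sum_mul, hw1, one_mul]
    exact_mod_cast this
  obtain ⟨u, hu⟩ := exists_fin_sum_eq (Y := Y) (fun a : Σ _ : Fin N, ℕ => some a.1) A P hcard
  refine ⟨u, ?_⟩
  rw [hu, hA, Finset.sum_sigma]
  simp only [Option.elim_some, Finset.sum_const, Finset.card_range]
  rw [Finset.smul_sum, ← Finset.sum_sub_distrib]
  have hterm : ∀ i ∈ Finset.univ, ‖w i • z i - (P : ℝ)⁻¹ • ⌊w i * P⌋₊ • z i‖ ≤ (P : ℝ)⁻¹ := by
    intro i _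
    have e : w i • z i - (P : ℝ)⁻¹ • ⌊w i * P⌋₊ • z i =
        ((P : ℝ)⁻¹ * (w i * P - ⌊w i * P⌋₊)) • z i := by
      rw [← Nat.cast_smul_eq_nsmul ℝ, smul_smul, ← sub_smul]
      congr 1; field_simp
    have h1 := Nat.floor_le (mul_nonneg (hw0 i) hP'.le)
    have h2 := (Nat.lt_floor_add_one (w i * P)).le
    rw [e, norm_smul, Real.norm_of_nonneg (mul_nonneg (by positivity) (by linarith))]
    calc (P : ℝ)⁻¹ * (w i * P - ⌊w i * P⌋₊) * ‖z i‖ ≤ (P : ℝ)⁻¹ * 1 * 1 := by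
          gcongr
          · linarith
          · exact hz i
      _ = (P : ℝ)⁻¹ := by ring
  refine (norm_sum_le_of_le _ hterm).trans (le_of_eq ?_)
  simp [div_eq_mul_inv]

/-- Convex combinations of vectors of the unit ball are `δ`-close to averages of `m` of these
vectors and zeros. -/
def HasAverageApprox (Y : Type*) [NormedAddCommGroup Y] [NormedSpace ℝ Y] (δ : ℝ) (m : ℕ) : Prop :=
  ∀ (N : ℕ) (z : Fin N → Y), (∀ i, ‖z i‖ ≤ 1) → ∀ w : Fin N → ℝ, (∀ i, 0 ≤ w i) → ∑ i, w i = 1 →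
    ∃ σ : Fin m → Option (Fin N), ‖∑ i, w i • z i - (m : ℝ)⁻¹ • ∑ j, (σ j).elim 0 z‖ ≤ δ

/-- Maurey's empirical method, for a sign balanced space. -/
theorem exists_sparse_approx {n : ℕ} {θ : ℝ} (hn : 0 < n) (hθ0 : 0 < θ) (hθ1 : θ < 1) {δ : ℝ}
    (hδ : 0 < δ) : ∃ m : ℕ, m ≠ 0 ∧ ∀ (Y : Type*) [NormedAddCommGroup Y] [NormedSpace ℝ Y],
      SignBalanced Y (2 ^ n) θ → HasAverageApprox Y δ m := by
  have hs := summable_pow_div hn hθ0.le hθ1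
  -- Halving down to length `2 ^ k` costs a tail of this convergent series, whatever the initial
  -- length; so `k` is independent of `N` and of the space.
  obtain ⟨k, hk⟩ : ∃ k, ∀ J, ∑ i ∈ Finset.Ico (k + 1) (J + 1), θ ^ (i / n) ≤ δ / 2 := by
    have ht := (tendsto_sum_nat_add fun i => θ ^ (i / n)).comp (Filter.tendsto_add_atTop_nat 1)
    obtain ⟨k, hk⟩ := (ht.eventually (gt_mem_nhds (half_pos hδ))).exists
    refine ⟨k, fun J => ?_⟩
    rw [Finset.sum_Ico_eq_sum_range]
    refine le_trans ?_ hk.le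
    have := ((summable_nat_add_iff (k + 1)).2 hs).sum_le_tsum (Finset.range (J + 1 - (k + 1)))
      fun i _ => pow_nonneg hθ0.le _
    simpa [add_comm] using this
  refine ⟨2 ^ k, by positivity, fun Y _ _ hY N z hz w hw0 hw1 => ?_⟩
  have hdown : ∀ d (u : Fin (2 ^ (k + d)) → Option (Fin N)), ∃ v : Fin (2 ^ k) → Option (Fin N),
      ‖((2 ^ (k + d) : ℕ) : ℝ)⁻¹ • ∑ j, (u j).elim 0 z -
        ((2 ^ k : ℕ) : ℝ)⁻¹ • ∑ j, (v j).elim 0 z‖ ≤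
        ∑ i ∈ Finset.Ico (k + 1) (k + d + 1), θ ^ (i / n) := by
    intro d
    induction d with
    | zero => exact fun u => ⟨u, by simp⟩
    | succ d ih =>
      intro u
      obtain ⟨v, hv⟩ := (hY.two_pow hθ0 (k + d + 1)).exists_half (P := 2 ^ (k + d))
        (by positivity) z hz u
      obtain ⟨v', hv'⟩ := ih v
      refine ⟨v', ?_⟩
      rw [Finset.sum_Ico_succ_top (show k + 1 ≤ k + (d + 1) by omega)]
      refine (norm_sub_le_norm_sub_add_norm_sub _
        (((2 ^ (k + d) : ℕ) : ℝ)⁻¹ • ∑ j, (v j).elim 0 z) _).trans ?_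
      rw [add_comm]
      exact add_le_add hv' hv
  obtain ⟨d, hd⟩ : ∃ d : ℕ, (N : ℝ) / (2 ^ (k + d) : ℕ) ≤ δ / 2 := by
    obtain ⟨d, hd⟩ := exists_nat_gt (N / (δ / 2))
    refine ⟨d, ?_⟩
    have h1 : (d : ℝ) ≤ (2 ^ (k + d) : ℕ) := by
      exact_mod_cast (Nat.le_add_left d k).trans Nat.lt_two_pow_self.le
    rw [div_le_comm₀ (by positivity) (by positivity)]
    linarith
  obtain ⟨u, hu⟩ := exists_dyadic_approx z hz w hw0 hw1 (2 ^ (k + d)) (by positivity)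
  obtain ⟨v, hv⟩ := hdown d u
  refine ⟨v, (norm_sub_le_norm_sub_add_norm_sub _
    (((2 ^ (k + d) : ℕ) : ℝ)⁻¹ • ∑ j, (u j).elim 0 z) _).trans ?_⟩
  linarith [hk (k + d)]

end balance

/-! ### Moments of Rademacher sums -/

section cube

theorem rademacher_mul {n : ℕ} (i : Fin n) (ω ω' : Fin n → ℤˣ) :
    rademacher i (ω * ω') = rademacher i ω * rademacher i ω' := by
  simp [rademacher]

theorem sum_cube_succ {n : ℕ} (φ : ℝ → ℝ) :
    ∑ ω : Fin (n + 1) → ℤˣ, φ (∑ i, rademacher i ω) =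
      ∑ ω : Fin n → ℤˣ, (φ (1 + ∑ i, rademacher i ω) + φ (-1 + ∑ i, rademacher i ω)) := by
  rw [← Equiv.sum_comp (Fin.consEquiv fun _ => ℤˣ), Fintype.sum_prod_type, Finset.sum_comm]
  refine Finset.sum_congr rfl fun ω _ => ?_
  rw [UnitsInt.univ, Finset.sum_pair (by decide)]
  simp [Fin.sum_univ_succ, rademacher]

theorem sum_cube_const (n : ℕ) (c : ℝ) : ∑ _ω : Fin n → ℤˣ, c = 2 ^ n * c := by
  simp

theorem sum_cube_sq (n : ℕ) : ∑ ω : Fin n → ℤˣ, (∑ i, rademacher i ω) ^ 2 = 2 ^ n * n := by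
  induction n with
  | zero => simp
  | succ n ih =>
    rw [sum_cube_succ (fun x => x ^ 2)]
    have : ∀ ω : Fin n → ℤˣ, ((1 + ∑ i, rademacher i ω) ^ 2 + (-1 + ∑ i, rademacher i ω) ^ 2) =
        2 * (∑ i, rademacher i ω) ^ 2 + 2 := fun ω => by ring
    simp only [this, Finset.sum_add_distrib, ← Finset.mul_sum, ih, sum_cube_const]
    push_cast; ring

theorem sum_cube_four (n : ℕ) :
    ∑ ω : Fin n → ℤˣ, (∑ i, rademacher i ω) ^ 4 = 2 ^ n * (3 * n ^ 2 - 2 * n) := by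
  induction n with
  | zero => simp
  | succ n ih =>
    rw [sum_cube_succ (fun x => x ^ 4)]
    have : ∀ ω : Fin n → ℤˣ, ((1 + ∑ i, rademacher i ω) ^ 4 + (-1 + ∑ i, rademacher i ω) ^ 4) =
        2 * (∑ i, rademacher i ω) ^ 4 + 12 * (∑ i, rademacher i ω) ^ 2 + 2 := fun ω => by ring
    simp only [this, Finset.sum_add_distrib, ← Finset.mul_sum, ih, sum_cube_const, sum_cube_sq]
    push_cast; ring

/-- Khintchine's lower bound for the first moment. -/
theorem sum_cube_abs_ge (k : ℕ) :
    (2 : ℝ) ^ (k ^ 2) * (k / 2) ≤ ∑ ω : Fin (k ^ 2) → ℤˣ, |∑ i, rademacher i ω| := by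
  rcases Nat.eq_zero_or_pos k with rfl | hk
  · simp
  have hk' : (0 : ℝ) < k := by exact_mod_cast hk
  -- A minorant of `|x|` using only second and fourth moments. The extremal point is `|x| = √2 * k`,
  -- hence the approximation `7 / 5` of `√2` in the squares below.
  have hpt : ∀ x : ℝ, x ^ 2 / k - x ^ 4 / (6 * k ^ 3) ≤ |x| := by
    intro x
    have hx : 0 ≤ |x| := abs_nonneg x
    rw [← sq_abs, show x ^ 4 = |x| ^ 4 by rw [← abs_pow, abs_of_nonneg (by positivity)]]
    set t := |x| with ht
    have h1 : t ^ 2 / k - t ^ 4 / (6 * k ^ 3) = t * (6 * k ^ 2 * t - t ^ 3) / (6 * k ^ 3) := by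
      field_simp
    rw [h1, div_le_iff₀ (by positivity)]
    apply mul_le_mul_of_nonneg_left _ hx
    nlinarith [mul_nonneg hx (sq_nonneg (5 * t - 7 * k)), mul_nonneg hk'.le (sq_nonneg (5 * t - 7 * k)),
      pow_pos hk' 3]
  calc (2 : ℝ) ^ (k ^ 2) * (k / 2) ≤
      2 ^ (k ^ 2) * (k ^ 2 : ℕ) / k - 2 ^ (k ^ 2) * (3 * (k ^ 2 : ℕ) ^ 2 - 2 * (k ^ 2 : ℕ)) / (6 * k ^ 3) := by
        have : (2 : ℝ) ^ (k ^ 2) * (k ^ 2 : ℕ) / k -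
            2 ^ (k ^ 2) * (3 * (k ^ 2 : ℕ) ^ 2 - 2 * (k ^ 2 : ℕ)) / (6 * k ^ 3) =
            2 ^ (k ^ 2) * (k / 2) + 2 ^ (k ^ 2) * (1 / (3 * k)) := by
          push_cast; field_simp; ring
        rw [this]
        have : (0 : ℝ) ≤ 2 ^ (k ^ 2) * (1 / (3 * k)) := by positivity
        linarith
    _ = ∑ ω : Fin (k ^ 2) → ℤˣ, ((∑ i, rademacher i ω) ^ 2 / k -
          (∑ i, rademacher i ω) ^ 4 / (6 * k ^ 3)) := by
        rw [Finset.sum_sub_distrib, ← Finset.sum_div, ← Finset.sum_div, sum_cube_sq, sum_cube_four]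
    _ ≤ _ := Finset.sum_le_sum fun ω _ => hpt _

end cube

/-! ### From K-convexity to sign balancing, for the space and its dual -/

section weak

/-- The Rademacher projections are bounded from `L_∞` to `L_1`, uniformly in the dimension. -/
def RademacherBounded (Y : Type*) [NormedAddCommGroup Y] [NormedSpace ℝ Y] (C : ℝ) : Prop :=
  ∀ (n : ℕ) (f : (Fin n → ℤˣ) → Y), (∀ ω, ‖f ω‖ ≤ 1) →
    cubeMean (fun ω => ‖rademacherProj f ω‖) ≤ C

theorem cubeMean_norm_le_cubeL2Norm {n : ℕ} {Y : Type*} [NormedAddCommGroup Y]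
    (f : (Fin n → ℤˣ) → Y) :
    cubeMean (fun ω => ‖f ω‖) ≤ cubeL2Norm f := by
  unfold cubeL2Norm
  apply Real.le_sqrt_of_sq_le
  have := sq_sum_le_card_mul_sum_sq (s := (Finset.univ : Finset (Fin n → ℤˣ))) (f := fun ω => ‖f ω‖)
  simp only [Finset.card_univ, Fintype.card_pi, Finset.prod_const, Fintype.card_fin,
    Fintype.card_units_int] at this
  push_cast at this
  unfold cubeMean
  simp only [smul_eq_mul]
  rw [mul_pow, inv_pow, inv_mul_le_iff₀ (by positivity)]
  refine this.trans (le_of_eq ?_)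
  field_simp

variable {Y : Type*} [NormedAddCommGroup Y] [NormedSpace ℝ Y]

theorem cubeMean_mono {n : ℕ} {f g : (Fin n → ℤˣ) → ℝ} (h : ∀ ω, f ω ≤ g ω) :
    cubeMean f ≤ cubeMean g := by
  unfold cubeMean
  simp only [smul_eq_mul]
  exact mul_le_mul_of_nonneg_left (Finset.sum_le_sum fun ω _ => h ω) (by positivity)

theorem cubeMean_const (n : ℕ) (c : ℝ) : cubeMean (fun _ : Fin n → ℤˣ => c) = c := by
  unfold cubeMean
  rw [sum_cube_const, smul_eq_mul, inv_mul_cancel_left₀ (by positivity)]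

/-- On a probability space `L_1 ≤ L_2 ≤ L_∞`. The summand 1 gives room to pick an admissible
constant near the infimum. -/
theorem exists_rademacherBounded_of_kConvexityConst_le {κ : ℝ≥0}
    (h : kConvexityConst Y ≤ (κ : ℝ≥0∞)) : RademacherBounded Y (κ + 1) := by
  have hlt : kConvexityConst Y < ((κ + 1 : ℝ≥0) : ℝ≥0∞) :=
    h.trans_lt (ENNReal.coe_lt_coe.2 (lt_add_one κ))
  unfold kConvexityConst at hlt
  simp only [iInf_lt_iff] at hlt
  obtain ⟨C, hC, hCκ⟩ := hlt
  intro n f hf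
  refine (cubeMean_norm_le_cubeL2Norm _).trans ((hC n f).trans ?_)
  have h1 : cubeL2Norm f ≤ 1 := by
    unfold cubeL2Norm
    rw [Real.sqrt_le_one, ← cubeMean_const n 1]
    exact cubeMean_mono fun ω => pow_le_one₀ (norm_nonneg _) (hf ω)
  have h2 : (C : ℝ) ≤ κ + 1 := by exact_mod_cast (ENNReal.coe_lt_coe.1 hCκ).le
  calc (C : ℝ) * cubeL2Norm f ≤ C * 1 := by gcongr
    _ ≤ κ + 1 := by simpa using h2

/-- Convolution form of the projection: the kernel depends only on `ω * t`, hence is symmetric. -/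
theorem rademacherProj_apply {n : ℕ} {X : Type*} [AddCommGroup X] [Module ℝ X]
    (f : (Fin n → ℤˣ) → X) (ω : Fin n → ℤˣ) :
    rademacherProj f ω = ∑ t, ((2 ^ n : ℝ)⁻¹ * ∑ i, rademacher i (ω * t)) • f t := by
  unfold rademacherProj cubeMean
  simp only [Finset.smul_sum, smul_smul, Finset.mul_sum, Finset.sum_smul, rademacher_mul]
  rw [Finset.sum_comm]
  refine Finset.sum_congr rfl fun t _ => Finset.sum_congr rfl fun i _ => ?_
  congr 1; ring

/-- The Rademacher projection is its own transpose. -/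
theorem sum_rademacherProj_apply {n : ℕ} (g : (Fin n → ℤˣ) → StrongDual ℝ Y)
    (f : (Fin n → ℤˣ) → Y) :
    ∑ ω, rademacherProj g ω (f ω) = ∑ ω, g ω (rademacherProj f ω) := by
  simp only [rademacherProj_apply, sum_apply, map_sum,
    smul_apply, map_smul]
  rw [Finset.sum_comm]
  simp only [mul_comm]

/-- Test the projected functionals on almost norming vectors and move the projection onto these. The
extra 1 pays for norms that are not attained. -/
theorem RademacherBounded.dual {C : ℝ} (h : RademacherBounded Y C) :
    RademacherBounded (StrongDual ℝ Y) (C + 1) := by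
  intro n g hg
  have hx : ∀ ω, ∃ x : Y, ‖x‖ ≤ 1 ∧ ‖rademacherProj g ω‖ - 1 ≤ rademacherProj g ω x := by
    intro ω
    obtain ⟨x, hx, hlt⟩ := (rademacherProj g ω).exists_lt_apply_of_lt_opNorm
      (r := ‖rademacherProj g ω‖ - 1) (by linarith)
    rw [Real.norm_eq_abs] at hlt
    rcases abs_cases (rademacherProj g ω x) with h1 | h1
    · exact ⟨x, hx.le, by linarith⟩
    · exact ⟨-x, by simpa using hx.le, by simp; linarith⟩
  choose x hx1 hx2 using hx
  calc cubeMean (fun ω => ‖rademacherProj g ω‖)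
      ≤ cubeMean (fun ω => rademacherProj g ω (x ω) + 1) :=
        cubeMean_mono fun ω => by linarith [hx2 ω]
    _ = cubeMean (fun ω => g ω (rademacherProj x ω)) + 1 := by
        conv_rhs => rw [← cubeMean_const n 1]
        unfold cubeMean
        rw [Finset.sum_add_distrib, smul_add, sum_rademacherProj_apply]
    _ ≤ cubeMean (fun ω => ‖rademacherProj x ω‖) + 1 := by
        gcongr
        refine cubeMean_mono fun ω => ?_
        refine (Real.le_norm_self _).trans (((g ω).le_opNorm _).trans ?_)
        exact mul_le_of_le_one_left (norm_nonneg _) (hg ω)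
    _ ≤ C + 1 := by gcongr; exact h n x hx1

/-- Vectors all of whose signed sums are nearly maximal span `ℓ_1` with constant `2`. -/
theorem half_sum_abs_le_norm_sum {ι : Type*} [Fintype ι] (z : ι → Y) (hz : ∀ i, ‖z i‖ ≤ 1)
    (h : ∀ ε : ι → ℝ, (∀ i, ε i = 1 ∨ ε i = -1) →
      (Fintype.card ι : ℝ) - 1 / 2 < ‖∑ i, ε i • z i‖) (a : ι → ℝ) :
    (∑ i, |a i|) / 2 ≤ ‖∑ i, a i • z i‖ := by
  classical
  set ε : ι → ℝ := fun i => if 0 ≤ a i then 1 else -1 with hε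
  have hε1 : ∀ i, ε i = 1 ∨ ε i = -1 := fun i => by simp only [hε]; split_ifs <;> simp
  -- `φ` norms the sum carrying the signs of `a`. The total deficit of the numbers `ε i * φ (z i)`
  -- from 1 is below `1 / 2`, so each is at least `1 / 2`.
  obtain ⟨φ, hφ1, hφ⟩ := exists_dual_vector'' ℝ (∑ i, ε i • z i)
  have hle : ∀ i, ε i * φ (z i) ≤ 1 := by
    intro i
    have h1 : |φ (z i)| ≤ 1 := by
      rw [← Real.norm_eq_abs]
      exact (φ.le_opNorm _).trans (mul_le_one₀ hφ1 (norm_nonneg _) (hz i))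
    rw [abs_le] at h1
    rcases hε1 i with h2 | h2 <;> rw [h2] <;> linarith
  have hsum : (Fintype.card ι : ℝ) - 1 / 2 < ∑ i, ε i * φ (z i) := by
    have h1 := h ε hε1
    simp only [map_sum, map_smul, smul_eq_mul] at hφ
    rw [hφ]
    exact h1
  have hge : ∀ i, 1 / 2 ≤ ε i * φ (z i) := by
    intro i
    have h1 : ∑ j, (1 - ε j * φ (z j)) ≤ 1 / 2 := by
      rw [Finset.sum_sub_distrib]
      simp only [Finset.sum_const, Finset.card_univ, nsmul_eq_mul, mul_one]
      linarith
    have h2 := Finset.single_le_sum (f := fun j => 1 - ε j * φ (z j))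
      (fun j _ => by linarith [hle j]) (Finset.mem_univ i)
    linarith
  have habs : ∀ i, a i = |a i| * ε i := by
    intro i
    simp only [hε]
    split_ifs with h1
    · rw [abs_of_nonneg h1, mul_one]
    · rw [abs_of_neg (not_le.1 h1)]; ring
  calc (∑ i, |a i|) / 2 = ∑ i, |a i| * (1 / 2) := by rw [← Finset.sum_mul]; ring
    _ ≤ ∑ i, |a i| * (ε i * φ (z i)) :=
        Finset.sum_le_sum fun i _ => mul_le_mul_of_nonneg_left (hge i) (abs_nonneg _)
    _ = φ (∑ i, a i • z i) := by
        simp only [map_sum, map_smul, smul_eq_mul]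
        refine Finset.sum_congr rfl fun i _ => ?_
        conv_rhs => rw [habs i]
        ring
    _ ≤ ‖φ‖ * ‖∑ i, a i • z i‖ := (Real.le_norm_self _).trans (φ.le_opNorm _)
    _ ≤ ‖∑ i, a i • z i‖ := mul_le_of_le_one_left (norm_nonneg _) hφ1

/-- Index a counterexample by the cube `{-1, 1}^(k ^ 2)` and project it. By the `ℓ_1` estimate and
Khintchine, every value of the projection has norm at least `k / 4 > C`. -/
theorem RademacherBounded.signBalanced {C : ℝ} (h : RademacherBounded Y C) {k : ℕ}
    (hk : 4 * C < k) : SignBalanced Y (2 ^ (k ^ 2)) (1 - 1 / 2 / (2 ^ (k ^ 2) : ℕ)) := by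
  set n := k ^ 2
  by_contra hcon
  unfold SignBalanced at hcon
  push Not at hcon
  obtain ⟨z, hz, hlt⟩ := hcon
  have hcard : Fintype.card (Fin n → ℤˣ) = 2 ^ n := by simp
  let e : (Fin n → ℤˣ) ≃ Fin (2 ^ n) := Fintype.equivFinOfCardEq hcard
  have key := half_sum_abs_le_norm_sum (fun t => z (e t)) (fun t => hz _) (fun ε hε => by
    have h1 := hlt (fun i => ε (e.symm i)) fun i => hε _
    rw [← Equiv.sum_comp e] at h1
    simp only [Equiv.symm_apply_apply] at h1
    refine lt_of_eq_of_lt ?_ h1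
    rw [hcard, sub_mul, one_mul, div_mul_cancel₀ _ (by positivity)])
  have h1 := h n (fun t => z (e t)) fun t => hz _
  have h2 : ∀ ω, (k : ℝ) / 4 ≤ ‖rademacherProj (fun t => z (e t)) ω‖ := by
    intro ω
    rw [rademacherProj_apply]
    refine le_trans ?_ (key _)
    have h3 : ∑ t, |(2 ^ n : ℝ)⁻¹ * ∑ i, rademacher i (ω * t)| =
        (2 ^ n : ℝ)⁻¹ * ∑ t : Fin n → ℤˣ, |∑ i, rademacher i t| := by
      rw [← Equiv.sum_comp (Equiv.mulLeft ω) (fun t => |∑ i, rademacher i t|), Finset.mul_sum]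
      refine Finset.sum_congr rfl fun t _ => ?_
      rw [abs_mul, abs_of_pos (by positivity), Equiv.coe_mulLeft]
    have h4 := sum_cube_abs_ge k
    have h5 : (k : ℝ) / 2 ≤ (2 ^ n : ℝ)⁻¹ * ∑ t : Fin n → ℤˣ, |∑ i, rademacher i t| := by
      rw [le_inv_mul_iff₀ (by positivity)]
      exact h4
    rw [h3]
    linarith
  have h6 := cubeMean_mono h2
  rw [cubeMean_const] at h6
  linarith

end weak

/-! ### The duality pairing at scale `s` -/

section dual

variable {X : Type*} [NormedAddCommGroup X] [NormedSpace ℝ X]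

/-- The duality pairing, divided by `s`. -/
noncomputable def scaledPairing (X : Type*) [NormedAddCommGroup X] [NormedSpace ℝ X] (s : ℝ) :
    X →ₗ[ℝ] StrongDual ℝ X →ₗ[ℝ] ℝ :=
  LinearMap.mk₂ ℝ (fun x y => s⁻¹ * y x) (fun x x' y => by simp [mul_add])
    (fun c x y => by simp; ring) (fun x y y' => by simp [mul_add]) (fun c x y => by simp; ring)

@[simp]
theorem scaledPairing_apply (s : ℝ) (x : X) (y : StrongDual ℝ X) :
    scaledPairing X s x y = s⁻¹ * y x := rfl

/-- The functionals which are at most `s` on `T`. -/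
def dualPolar (T : Set X) (s : ℝ) : Set (StrongDual ℝ X) := {y | ∀ x ∈ T, y x ≤ s}

theorem zero_mem_dualPolar (T : Set X) {s : ℝ} (hs : 0 ≤ s) : (0 : StrongDual ℝ X) ∈ dualPolar T s :=
  fun _ _ => by simpa using hs

theorem exists_dual_apply_eq_norm (x : X) : ∃ y : StrongDual ℝ X, ‖y‖ ≤ 1 ∧ y x = ‖x‖ := by
  obtain ⟨y, h1, h2⟩ := exists_dual_vector'' ℝ x
  exact ⟨y, h1, by simpa using h2⟩

theorem apply_le_of_norm_le {y : StrongDual ℝ X} {x : X} {a b : ℝ} (hy : ‖y‖ ≤ a) (hx : ‖x‖ ≤ b) :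
    y x ≤ a * b :=
  (Real.le_norm_self _).trans (y.le_of_opNorm_le_of_le hy hx)

theorem elim_smul {ι Y : Type*} [AddCommGroup Y] [Module ℝ Y] (c : ℝ) (z : ι → Y) (o : Option ι) :
    o.elim 0 (fun i => c • z i) = c • o.elim 0 z := by
  cases o <;> simp

theorem hasSparseApprox_scaledPairing {m : ℕ} {R s : ℝ} (hR : 0 < R) (hs : 0 < s)
    (h : HasAverageApprox X (1 / (32 * R)) m) {K : Set X} (hK : ∀ x ∈ K, ‖x‖ ≤ R * s) :
    HasSparseApprox (scaledPairing X s) K (Metric.closedBall 0 1) (1 / 32) m := by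
  intro N k hk w hw0 hw1
  have hRs : 0 < R * s := mul_pos hR hs
  obtain ⟨σ, hσ⟩ := h N (fun i => (R * s)⁻¹ • k i) (fun i => by
    rw [norm_smul, Real.norm_of_nonneg (by positivity), inv_mul_le_iff₀ hRs, mul_one]
    exact hK _ (hk i)) w hw0 hw1
  refine ⟨σ, fun y hy => ?_⟩
  rw [mem_closedBall_zero_iff] at hy
  have e : ∑ i, w i • (R * s)⁻¹ • k i -
      (m : ℝ)⁻¹ • ∑ j, (σ j).elim 0 (fun i => (R * s)⁻¹ • k i) =
      (R * s)⁻¹ • (∑ i, w i • k i - (m : ℝ)⁻¹ • ∑ j, (σ j).elim 0 k) := by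
    simp only [elim_smul, smul_comm _ (R * s)⁻¹, ← Finset.smul_sum, smul_sub]
  rw [e, norm_smul, Real.norm_of_nonneg (by positivity), inv_mul_le_iff₀ hRs] at hσ
  have h1 := apply_le_of_norm_le hy hσ
  rw [scaledPairing_apply, inv_mul_le_iff₀ hs]
  refine h1.trans (le_of_eq ?_)
  field_simp

theorem hasSparseApprox_scaledPairing_flip {m : ℕ} {R s : ℝ} (hR : 0 < R) (hs : 0 < s)
    (h : HasAverageApprox (StrongDual ℝ X) (1 / (32 * R)) m) {L : Set X}
    (hL : ∀ x ∈ L, ‖x‖ ≤ R * s) :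
    HasSparseApprox (scaledPairing X s).flip (Metric.closedBall 0 1) L (1 / 32) m := by
  intro N k hk w hw0 hw1
  obtain ⟨σ, hσ⟩ := h N k (fun i => mem_closedBall_zero_iff.1 (hk i)) w hw0 hw1
  refine ⟨σ, fun x hx => ?_⟩
  have h1 := apply_le_of_norm_le hσ (hL x hx)
  rw [LinearMap.flip_apply, scaledPairing_apply, inv_mul_le_iff₀ hs]
  refine h1.trans (le_of_eq ?_)
  field_simp

theorem abs_scaledPairing_le {R s : ℝ} (hs : 0 < s) {x : X} (hx : ‖x‖ ≤ R * s) {y : StrongDual ℝ X}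
    (hy : y ∈ Metric.closedBall (0 : StrongDual ℝ X) 1) : |scaledPairing X s x y| ≤ R := by
  rw [mem_closedBall_zero_iff] at hy
  have h1 : ‖y x‖ ≤ 1 * (R * s) := y.le_of_opNorm_le_of_le hy hx
  rw [scaledPairing_apply, abs_mul, abs_of_pos (by positivity), inv_mul_le_iff₀ hs,
    ← Real.norm_eq_abs]
  linarith

/-- If a functional is bounded by `α` on `T ∩ ρ B` then it is the sum of a functional bounded by `α`
on `T` and a functional of norm at most `α / ρ`. -/
theorem exists_dual_decomposition {T : Set X} (hT : Convex ℝ T) (h0 : (0 : X) ∈ T) {α ρ : ℝ}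
    (hα : 0 < α) (hρ : 0 < ρ) (u : StrongDual ℝ X)
    (hu : ∀ t ∈ T, ‖t‖ ≤ ρ → u t ≤ α) :
    ∃ w : StrongDual ℝ X, ‖w‖ ≤ α / ρ ∧ ∀ t ∈ T, u t - w t ≤ α := by
  -- Separate the strict epigraph of `(α / ρ) * ‖·‖` from the graph of `u - α` over `T`. They are
  -- disjoint because points of `T` outside the ball can be shrunk to norm `ρ`. The separating
  -- functional, divided by its vertical slope `μ`, is `w`.
  set A : Set (X × ℝ) := {p | α / ρ * ‖p.1‖ < p.2} with hA
  set C : Set (X × ℝ) := {p | p.1 ∈ T ∧ p.2 = u p.1 - α} with hC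
  have hAo : IsOpen A := isOpen_lt (by fun_prop) (by fun_prop)
  have hαρ : 0 < α / ρ := div_pos hα hρ
  have hAc : Convex ℝ A := by
    intro p hp q hq a b ha hb hab
    simp only [hA, Set.mem_ofPred_eq, Prod.fst_add, Prod.snd_add, Prod.smul_fst, Prod.smul_snd,
      smul_eq_mul] at hp hq ⊢
    have h1 : ‖a • p.1 + b • q.1‖ ≤ a * ‖p.1‖ + b * ‖q.1‖ := by
      refine (norm_add_le _ _).trans (le_of_eq ?_)
      rw [norm_smul, norm_smul, Real.norm_of_nonneg ha, Real.norm_of_nonneg hb]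
    have h2 : α / ρ * ‖a • p.1 + b • q.1‖ ≤ a * (α / ρ * ‖p.1‖) + b * (α / ρ * ‖q.1‖) := by
      refine (mul_le_mul_of_nonneg_left h1 hαρ.le).trans (le_of_eq ?_)
      ring
    rcases ha.eq_or_lt with rfl | ha'
    · have : b = 1 := by linarith
      subst this
      simpa using hq
    · have := mul_lt_mul_of_pos_left hp ha'
      have := mul_le_mul_of_nonneg_left hq.le hb
      linarith
  have hCc : Convex ℝ C := by
    intro p hp q hq a b ha hb hab
    simp only [hC, Set.mem_ofPred_eq, Prod.fst_add, Prod.snd_add, Prod.smul_fst, Prod.smul_snd,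
      smul_eq_mul] at hp hq ⊢
    refine ⟨hT hp.1 hq.1 ha hb hab, ?_⟩
    rw [hp.2, hq.2, map_add, map_smul, map_smul, smul_eq_mul, smul_eq_mul]
    linear_combination (-α) * hab
  have hdis : Disjoint A C := by
    rw [Set.disjoint_left]
    rintro ⟨t, r⟩ hp ⟨ht, hr⟩
    simp only [hA, Set.mem_ofPred_eq] at hp ht hr
    rw [hr] at hp
    rcases le_or_gt ‖t‖ ρ with h1 | h1
    · have := hu t ht h1
      have : 0 ≤ α / ρ * ‖t‖ := by positivity
      linarith
    · have htpos : 0 < ‖t‖ := hρ.trans h1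
      have h2 : (ρ / ‖t‖) • t ∈ T := hT.smul_mem_of_zero_mem h0 ht
        ⟨by positivity, (div_le_one htpos).2 h1.le⟩
      have h3 := hu _ h2 (by
        rw [norm_smul, Real.norm_of_nonneg (by positivity), div_mul_cancel₀ _ htpos.ne'])
      rw [map_smul, smul_eq_mul, div_mul_eq_mul_div, div_le_iff₀ htpos] at h3
      have h4 : u t ≤ α / ρ * ‖t‖ := by
        rw [div_mul_eq_mul_div, le_div_iff₀ hρ]; linarith
      linarith
  obtain ⟨f, c, hfA, hfC⟩ := geometric_hahn_banach_open hAc hAo hCc hdis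
  set φ : StrongDual ℝ X := f.comp (ContinuousLinearMap.inl ℝ X ℝ) with hφ
  set μ : ℝ := -f (0, 1) with hμ
  have hf : ∀ x r, f (x, r) = φ x - μ * r := by
    intro x r
    have : (x, r) = (x, (0 : ℝ)) + r • ((0 : X), (1 : ℝ)) := by simp
    rw [this, map_add, map_smul]
    simp [hφ, hμ]; ring
  have hC0 := hfC (0, u 0 - α) ⟨h0, rfl⟩
  rw [hf, map_zero, map_zero] at hC0
  have hApt : ∀ x r, α / ρ * ‖x‖ < r → φ x - μ * r < c := fun x r h => by
    rw [← hf]; exact hfA (x, r) h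
  have hμpos : 0 < μ := by
    have h1 := hApt 0 1 (by simp)
    rw [map_zero] at h1
    nlinarith
  -- The epigraph is a cone: a violation scaled by a large factor would exceed `c`.
  have hscale : ∀ x r, α / ρ * ‖x‖ < r → φ x ≤ μ * r := by
    intro x r h
    by_contra! hcon
    set d := φ x - μ * r with hd
    have hdpos : 0 < d := by linarith
    have h1 := hApt ((|c| / d + 1) • x) ((|c| / d + 1) * r) (by
      rw [norm_smul, Real.norm_of_nonneg (by positivity)]
      have : 0 < |c| / d + 1 := by positivity
      nlinarith)
    rw [map_smul, smul_eq_mul] at h1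
    have h2 : (|c| / d + 1) * φ x - μ * ((|c| / d + 1) * r) = |c| + d := by
      have : (|c| / d + 1) * φ x - μ * ((|c| / d + 1) * r) = (|c| / d + 1) * d := by rw [hd]; ring
      rw [this]; field_simp
    linarith [le_abs_self c]
  have hc0 : 0 ≤ c := by
    refine le_of_forall_pos_lt_add fun η hη => ?_
    have h1 := hApt 0 (η / μ) (by simp; positivity)
    rw [map_zero, mul_div_cancel₀ _ hμpos.ne'] at h1
    linarith
  have hbound : ∀ x, φ x ≤ μ * (α / ρ * ‖x‖) := by
    intro x
    refine le_of_forall_pos_le_add fun η hη => ?_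
    have := hscale x (α / ρ * ‖x‖ + η / μ) (by linarith [div_pos hη hμpos])
    rwa [mul_add, mul_div_cancel₀ _ hμpos.ne'] at this
  refine ⟨μ⁻¹ • φ, ContinuousLinearMap.opNorm_le_bound _ hαρ.le fun x => ?_, fun t ht => ?_⟩
  · rw [smul_apply, smul_eq_mul, norm_mul, Real.norm_of_nonneg (by positivity),
      inv_mul_le_iff₀ hμpos, Real.norm_eq_abs, abs_le']
    refine ⟨hbound x, ?_⟩
    have := hbound (-x)
    rwa [map_neg, norm_neg] at this
  · have h1 := hfC (t, u t - α) ⟨ht, rfl⟩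
    rw [hf] at h1
    rw [smul_apply, smul_eq_mul]
    have h2 : μ * (u t - μ⁻¹ * φ t) ≤ μ * α := by
      rw [mul_sub, mul_inv_cancel_left₀ hμpos.ne']; linarith
    exact le_of_mul_le_mul_left h2 hμpos

end dual

/-! ### Truncated sets and the induction over scales -/

section chain

open Metric (closedBall)

theorem sepNum_ball_antitone {X : Type*} [SeminormedAddCommGroup X] (T : Set X) {s t : ℝ}
    (hs : 0 < s) (h : s ≤ t) :
    sepNum T (closedBall 0 t) ≤ sepNum T (closedBall 0 s) :=
  sepNum_mono (by simpa using hs.le) le_rfl (Metric.closedBall_subset_closedBall h)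

variable {X : Type*} [NormedAddCommGroup X] [NormedSpace ℝ X]

theorem sepNum_inter_ball_le_dual_pow {T : Set X} (hTs : ∀ x ∈ T, -x ∈ T)
    {R s : ℝ} (hR : 0 < R) (hs : 0 < s) {m q : ℕ} (hm : m ≠ 0) (hq : 128 * R + 2 ≤ q)
    (h : HasAverageApprox X (1 / (32 * R)) m) :
    sepNum (T ∩ closedBall 0 (R * s)) (closedBall 0 (s / 2)) ≤
      sepNum (closedBall (0 : StrongDual ℝ X) 1) (dualPolar (T ∩ closedBall 0 (R * s)) (s / 128)) ^
        ((q + 1) * m) := by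
  set K := T ∩ closedBall (0 : X) (R * s) with hK
  have hKb : ∀ x ∈ K, ‖x‖ ≤ R * s := fun x hx => mem_closedBall_zero_iff.1 hx.2
  have key := sepNum_le_sepNum_flip_pow (β := scaledPairing X s) (K := K)
    (L := closedBall (0 : StrongDual ℝ X) 1) hm (hasSparseApprox_scaledPairing hR hs h hKb)
    (fun x hx => ⟨hTs x hx.1, by simpa using hx.2⟩) (convex_closedBall _ _)
    ⟨0, by simp⟩ (fun y hy => by simpa using hy)
    (fun x hx y hy => abs_scaledPairing_le hs (hKb x hx) hy) hq
  have e1 : sepNum K (closedBall 0 (s / 2)) ≤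
      sepNum K (polarAt (scaledPairing X s) (closedBall (0 : StrongDual ℝ X) 1) (1 / 4)) := by
    refine sepNum_mono (zero_mem_polarAt (by norm_num)) le_rfl fun x hx => ?_
    obtain ⟨y, hy1, hy2⟩ := exists_dual_apply_eq_norm x
    have := hx y (by simpa using hy1)
    rw [scaledPairing_apply, hy2, inv_mul_le_iff₀ hs] at this
    rw [mem_closedBall_zero_iff]
    linarith
  have e2 : polarAt (scaledPairing X s).flip K (1 / 128) = dualPolar K (s / 128) := by
    ext y
    refine forall₂_congr fun x _ => ?_
    rw [LinearMap.flip_apply, scaledPairing_apply, inv_mul_le_iff₀ hs, mul_one_div]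
  rw [e2] at key
  exact e1.trans key

theorem sepNum_dual_inter_ball_le_pow {T : Set X} (hTc : Convex ℝ T) (h0 : (0 : X) ∈ T)
    (hTs : ∀ x ∈ T, -x ∈ T)
    {R s : ℝ} (hR : 0 < R) (hs : 0 < s) {m q : ℕ} (hm : m ≠ 0) (hq : 128 * R + 2 ≤ q)
    (h : HasAverageApprox (StrongDual ℝ X) (1 / (32 * R)) m) :
    sepNum (closedBall (0 : StrongDual ℝ X) 1) (dualPolar (T ∩ closedBall 0 (R * s)) (s / 4)) ≤
      sepNum (T ∩ closedBall 0 (R * s)) (closedBall 0 (s / 128)) ^ ((q + 1) * m) := by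
  set K := T ∩ closedBall (0 : X) (R * s) with hK
  have hKb : ∀ x ∈ K, ‖x‖ ≤ R * s := fun x hx => mem_closedBall_zero_iff.1 hx.2
  have key := sepNum_le_sepNum_flip_pow (β := (scaledPairing X s).flip) (L := K)
    (K := closedBall (0 : StrongDual ℝ X) 1) hm (hasSparseApprox_scaledPairing_flip hR hs h hKb)
    (fun y hy => by simpa using hy) (hTc.inter (convex_closedBall _ _))
    ⟨0, h0, by simpa using (mul_pos hR hs).le⟩ (fun x hx => ⟨hTs x hx.1, by simpa using hx.2⟩)
    (fun y hy x hx => abs_scaledPairing_le hs (hKb x hx) hy) hq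
  have e1 : polarAt (scaledPairing X s).flip K (1 / 4) = dualPolar K (s / 4) := by
    ext y
    refine forall₂_congr fun x _ => ?_
    rw [LinearMap.flip_apply, scaledPairing_apply, inv_mul_le_iff₀ hs, mul_one_div]
  have e2 : sepNum K (polarAt (scaledPairing X s).flip.flip (closedBall (0 : StrongDual ℝ X) 1) (1 / 128)) ≤
      sepNum K (closedBall 0 (s / 128)) := by
    refine sepNum_mono (by simp; positivity) le_rfl fun x hx y hy => ?_
    rw [mem_closedBall_zero_iff] at hx hy
    have := apply_le_of_norm_le hy hx
    rw [LinearMap.flip_flip, scaledPairing_apply, inv_mul_le_iff₀ hs]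
    linarith
  rw [e1] at key
  exact key.trans (pow_le_pow_left' e2 _)

theorem half_smul_add_half_smul_mem {E : Type*} [AddCommGroup E] [Module ℝ E] {T : Set E}
    (hT : Convex ℝ T) {x y : E} (hx : x ∈ T) (hy : y ∈ T) :
    (1 / 2 : ℝ) • x + (1 / 2 : ℝ) • y ∈ T :=
  hT hx hy (by norm_num) (by norm_num) (by norm_num)

/-- Split along a coarse net; halving differences of points of `T` returns them to `T`, with radius
and scale halved. -/
theorem sepNum_ball_le_mul {T : Set X} (hTc : Convex ℝ T) (hTs : ∀ x ∈ T, -x ∈ T) {s : ℝ}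
    (hs : 0 < s) :
    sepNum T (closedBall 0 s) ≤ sepNum T (closedBall 0 (1024 * s)) * sepNum (T ∩ closedBall 0 (512 * s)) (closedBall 0 (s / 2)) := by
  refine (sepNum_le_mul (D' := closedBall (0 : X) (1024 * s)) (by simpa using hs.le) (by simpa using hs.le)
    fun x hx => by simpa using hx).trans ?_
  gcongr
  refine sepNum_le_of_map (fun x => (1 / 2 : ℝ) • x) (by simp; positivity) ?_ ?_
  · rintro x ⟨⟨a, ha, b, hb, rfl⟩, hx⟩
    refine ⟨?_, ?_⟩
    · have := half_smul_add_half_smul_mem hTc ha (hTs b hb)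
      rwa [← smul_add, ← sub_eq_add_neg] at this
    · rw [mem_closedBall_zero_iff] at hx ⊢
      rw [norm_smul, Real.norm_of_nonneg (by norm_num)]
      simp only at hx
      linarith
  · intro x _ y _ h
    rw [mem_closedBall_zero_iff] at h ⊢
    rw [← smul_sub, norm_smul, Real.norm_of_nonneg (by norm_num)] at h
    linarith

/-- A functional small on the truncated set is, up to `s / 4` on `T`, a functional of norm at most
`1 / 2048`. Scaling that part up by 2048 turns its scale `s / 2` into `1024 * s`, and `s / 4 + s / 4
+ s / 2 = s`. -/
theorem sepNum_dualPolar_le_mul {T : Set X} (hTc : Convex ℝ T) (h0 : (0 : X) ∈ T)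
    (hTs : ∀ x ∈ T, -x ∈ T) {s : ℝ} (hs : 0 < s) :
    sepNum (closedBall (0 : StrongDual ℝ X) 1) (dualPolar T s) ≤
      sepNum (closedBall (0 : StrongDual ℝ X) 1) (dualPolar (T ∩ closedBall 0 (512 * s)) (s / 4)) *
        sepNum (closedBall (0 : StrongDual ℝ X) 1) (dualPolar T (1024 * s)) := by
  refine (sepNum_le_mul (D' := dualPolar (T ∩ closedBall 0 (512 * s)) (s / 4))
    (zero_mem_dualPolar _ hs.le) (zero_mem_dualPolar _ (by positivity)) fun y hy x hx => ?_).trans ?_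
  · have := hy (-x) ⟨hTs x hx.1, by simpa using hx.2⟩
    simpa using this
  gcongr
  have hdec : ∀ u ∈ dualPolar (T ∩ closedBall 0 (512 * s)) (s / 4), ∃ w : StrongDual ℝ X,
      ‖w‖ ≤ s / 4 / (512 * s) ∧ ∀ t ∈ T, u t - w t ≤ s / 4 := fun u hu =>
    exists_dual_decomposition hTc h0 (by positivity) (by positivity) u fun t ht htn =>
      hu t ⟨ht, by simpa using htn⟩
  choose! φ hφn hφ using hdec
  refine sepNum_le_of_map (fun u => (2048 : ℝ) • φ u) (zero_mem_dualPolar _ (by positivity)) ?_ ?_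
  · rintro u ⟨-, hu⟩
    rw [mem_closedBall_zero_iff, norm_smul, Real.norm_of_nonneg (by norm_num)]
    have := hφn u hu
    have e : s / 4 / (512 * s) = 1 / 2048 := by field_simp; norm_num
    rw [e] at this
    linarith
  · rintro u ⟨-, hu⟩ u' ⟨-, hu'⟩ h t ht
    have h1 := hφ u hu t ht
    have h2 := hφ u' hu' (-t) (hTs t ht)
    have h3 := h t ht
    simp only [smul_apply, sub_apply, smul_eq_mul, map_neg] at h1 h2 h3 ⊢
    linarith

/-- In the midpoints `(x + z) / 2` the part `x - x'` has norm at most `1024 * s`, too small to hide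
a `2048 * s` separation of `z`; once `z` is known, `x` is determined. -/
theorem mul_sepNum_ball_le {T : Set X} (hTc : Convex ℝ T) {s : ℝ} (hs : 0 < s) :
    sepNum (T ∩ closedBall 0 (512 * s)) (closedBall 0 (s / 128)) * sepNum T (closedBall 0 (2048 * s)) ≤
      sepNum T (closedBall 0 (s / 512)) := by
  refine mul_sepNum_le (fun x z => (1 / 2 : ℝ) • x + (1 / 2 : ℝ) • z) (by simp; positivity)
    (fun x hx z hz => half_smul_add_half_smul_mem hTc hx.1 hz) ?_
  intro x hx x' hx' z hz z' hz' hxx hzz h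
  have e : (1 / 2 : ℝ) • x + (1 / 2 : ℝ) • z - ((1 / 2 : ℝ) • x' + (1 / 2 : ℝ) • z') =
      (1 / 2 : ℝ) • ((x - x') + (z - z')) := by
    simp only [smul_add, smul_sub]; abel
  simp only [mem_closedBall_zero_iff, e, norm_smul] at h hxx hzz
  rw [Real.norm_of_nonneg (by norm_num)] at h
  have hxn := hx.2
  have hxn' := hx'.2
  rw [mem_closedBall_zero_iff] at hxn hxn'
  have hzeq : z = z' := by
    refine hzz.resolve_right fun hcon => hcon ?_
    have h1 : ‖z - z'‖ ≤ ‖(x - x') + (z - z')‖ + ‖x - x'‖ := by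
      have := norm_sub_le ((x - x') + (z - z')) (x - x')
      rwa [add_sub_cancel_left] at this
    have h2 := norm_sub_le x x'
    linarith
  subst hzeq
  refine ⟨hxx.resolve_right fun hcon => hcon ?_, rfl⟩
  rw [sub_self, add_zero] at h
  linarith

/-- The weight `2 ^ (-20)` makes `v` contribute at most `s / 1024` on the truncated set, so `y` is
recovered there first. It still turns a separation of `v` by `2048 * s` on `T` into `s / 512`. -/
theorem mul_sepNum_dualPolar_le {T : Set X} {s : ℝ} (hs : 0 < s) :
    sepNum (closedBall (0 : StrongDual ℝ X) 1) (dualPolar (T ∩ closedBall 0 (512 * s)) (s / 128)) *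
        sepNum (closedBall (0 : StrongDual ℝ X) 1) (dualPolar T (2048 * s)) ≤
      sepNum (closedBall (0 : StrongDual ℝ X) 1) (dualPolar T (s / 512)) := by
  refine mul_sepNum_le (fun y v => (1 / 2 : ℝ) • y + (1 / 2 ^ 20 : ℝ) • v)
    (zero_mem_dualPolar _ (by positivity)) ?_ ?_
  · intro y hy v hv
    rw [mem_closedBall_zero_iff] at hy hv ⊢
    refine (norm_add_le _ _).trans ?_
    rw [norm_smul, norm_smul, Real.norm_of_nonneg (by norm_num), Real.norm_of_nonneg (by norm_num)]
    linarith
  intro y hy y' hy' v hv v' hv' hyy hvv h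
  rw [mem_closedBall_zero_iff] at hv hv'
  have hT : ∀ t ∈ T, 1 / 2 * (y t - y' t) + 1 / 2 ^ 20 * (v t - v' t) ≤ s / 512 := by
    intro t ht
    have := h t ht
    simp only [smul_apply, add_apply, sub_apply, smul_eq_mul] at this
    linarith
  have hyeq : y = y' := by
    refine hyy.resolve_right fun hcon => hcon fun x hx => ?_
    have h1 := hT x hx.1
    have hxn := hx.2
    rw [mem_closedBall_zero_iff] at hxn
    have h2 := apply_le_of_norm_le hv' hxn
    have h3 := apply_le_of_norm_le (y := -v) (by simpa using hv) hxn
    simp only [neg_apply, sub_apply] at h3 ⊢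
    linarith
  subst hyeq
  refine ⟨rfl, hvv.resolve_right fun hcon => hcon fun x hx => ?_⟩
  have h1 := hT x hx
  simp only [sub_apply]
  linarith

theorem sepNum_dualPolar_antitone (K : Set (StrongDual ℝ X)) (T : Set X) {s t : ℝ} (hs : 0 < s)
    (h : s ≤ t) : sepNum K (dualPolar T t) ≤ sepNum K (dualPolar T s) :=
  sepNum_mono (zero_mem_dualPolar _ hs.le) le_rfl fun _ hy x hx => (hy x hx).trans h

theorem scale_induction {P : ℝ → Prop} (r : ℝ) (hbase : ∀ s, 0 < s → r ≤ s → P s)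
    (hstep : ∀ s, 0 < s → P (1024 * s) → P s) : ∀ s, 0 < s → P s := by
  have key : ∀ n : ℕ, ∀ s, 0 < s → r ≤ 1024 ^ n * s → P s := by
    intro n
    induction n with
    | zero => intro s hs h; exact hbase s hs (by simpa using h)
    | succ n ih =>
      intro s hs h
      exact hstep s hs (ih _ (by positivity) (by rw [pow_succ] at h; linarith))
  intro s hs
  obtain ⟨n, hn⟩ := pow_unbounded_of_one_lt (r / s) (by norm_num : (1 : ℝ) < 1024)
  exact key n s hs ((div_le_iff₀ hs).1 hn.le)

theorem sepNum_ball_le_dual_pow_of_bounded {T : Set X} (hTc : Convex ℝ T) (hTs : ∀ x ∈ T, -x ∈ T)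
    {m q : ℕ} (hm : m ≠ 0) (hq : 128 * 512 + 2 ≤ q)
    (h : HasAverageApprox X (1 / (32 * 512)) m) {r : ℝ} (hr : ∀ x ∈ T, ‖x‖ ≤ r) {s : ℝ}
    (hs : 0 < s) :
    sepNum T (closedBall 0 s) ≤
      sepNum (closedBall (0 : StrongDual ℝ X) 1) (dualPolar T (s / 512)) ^ (2 * ((q + 1) * m)) := by
  set b := (q + 1) * m
  set f : ℝ → ℕ∞ := fun s => sepNum (closedBall (0 : StrongDual ℝ X) 1) (dualPolar T s) with hf
  have hf1 : ∀ s, 1 ≤ f s := fun s => one_le_sepNum ⟨0, by simp⟩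
  -- In the step from `1024 * s` to `s`, the old factor `f (2048 * s)` is absorbed with the
  -- truncated number into `f (s / 512)`, and `f (2 * s)` is kept. Thus `b` stays fixed.
  have claim : ∀ s, 0 < s → sepNum T (closedBall 0 s) ≤ (f (s / 512) * f (2 * s)) ^ b := by
    refine scale_induction (2 * r) (fun s hs hrs => ?_) fun s hs ih => ?_
    · refine (sepNum_le_one fun x hx y hy => ?_).trans
        (one_le_pow_of_one_le' (one_le_mul (hf1 _) (hf1 _)) b)
      rw [mem_closedBall_zero_iff]
      linarith [norm_sub_le x y, hr x hx, hr y hy]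
    · have e1 : 1024 * s / 512 = 2 * s := by ring
      have e2 : 2 * (1024 * s) = 2048 * s := by ring
      rw [e1, e2] at ih
      calc sepNum T (closedBall 0 s) ≤ _ := sepNum_ball_le_mul hTc hTs hs
        _ ≤ (f (2 * s) * f (2048 * s)) ^ b * sepNum (closedBall (0 : StrongDual ℝ X) 1)
            (dualPolar (T ∩ closedBall 0 (512 * s)) (s / 128)) ^ b :=
          mul_le_mul' ih (sepNum_inter_ball_le_dual_pow hTs (by norm_num) hs hm
            (by exact_mod_cast hq) h)
        _ = ((sepNum (closedBall (0 : StrongDual ℝ X) 1) (dualPolar (T ∩ closedBall 0 (512 * s)) (s / 128)) *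
              f (2048 * s)) * f (2 * s)) ^ b := by
          rw [← mul_pow]; congr 1; ring
        _ ≤ (f (s / 512) * f (2 * s)) ^ b :=
          pow_le_pow_left' (mul_le_mul_left (mul_sepNum_dualPolar_le hs) _) b
  refine (claim s hs).trans ?_
  rw [pow_mul _ 2 b, sq]
  exact pow_le_pow_left' (mul_le_mul_right (sepNum_dualPolar_antitone _ T (by positivity)
    (by linarith)) _) b

theorem sepNum_dual_le_pow_of_bounded {T : Set X} (hTc : Convex ℝ T) (h0 : (0 : X) ∈ T)
    (hTs : ∀ x ∈ T, -x ∈ T) {m q : ℕ} (hm : m ≠ 0) (hq : 128 * 512 + 2 ≤ q)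
    (h : HasAverageApprox (StrongDual ℝ X) (1 / (32 * 512)) m) {r : ℝ} (hr : ∀ x ∈ T, ‖x‖ ≤ r)
    {s : ℝ} (hs : 0 < s) :
    sepNum (closedBall (0 : StrongDual ℝ X) 1) (dualPolar T s) ≤
      sepNum T (closedBall 0 (s / 512)) ^ (2 * ((q + 1) * m)) := by
  set b := (q + 1) * m
  set f : ℝ → ℕ∞ := fun s => sepNum T (closedBall 0 s) with hf
  have hf1 : ∀ s, 1 ≤ f s := fun s => one_le_sepNum ⟨0, h0⟩
  have claim : ∀ s, 0 < s → sepNum (closedBall (0 : StrongDual ℝ X) 1) (dualPolar T s) ≤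
      (f (s / 512) * f (2 * s)) ^ b := by
    refine scale_induction (2 * r) (fun s hs hrs => ?_) fun s hs ih => ?_
    · refine (sepNum_le_one fun y hy y' hy' x hx => ?_).trans
        (one_le_pow_of_one_le' (one_le_mul (hf1 _) (hf1 _)) b)
      rw [mem_closedBall_zero_iff] at hy hy'
      have := apply_le_of_norm_le (y := y - y') ((norm_sub_le y y').trans (add_le_add hy hy'))
        (hr x hx)
      linarith
    · have e1 : 1024 * s / 512 = 2 * s := by ring
      have e2 : 2 * (1024 * s) = 2048 * s := by ring
      rw [e1, e2] at ih
      calc sepNum (closedBall (0 : StrongDual ℝ X) 1) (dualPolar T s) ≤ _ :=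
            sepNum_dualPolar_le_mul hTc h0 hTs hs
        _ ≤ sepNum (T ∩ closedBall 0 (512 * s)) (closedBall 0 (s / 128)) ^ b * (f (2 * s) * f (2048 * s)) ^ b :=
          mul_le_mul' (sepNum_dual_inter_ball_le_pow hTc h0 hTs (by norm_num) hs hm
            (by exact_mod_cast hq) h) ih
        _ = ((sepNum (T ∩ closedBall 0 (512 * s)) (closedBall 0 (s / 128)) * f (2048 * s)) * f (2 * s)) ^ b := by
          rw [← mul_pow]; congr 1; ring
        _ ≤ (f (s / 512) * f (2 * s)) ^ b :=
          pow_le_pow_left' (mul_le_mul_left (mul_sepNum_ball_le hTc hs) _) b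
  refine (claim s hs).trans ?_
  rw [pow_mul _ 2 b, sq]
  exact pow_le_pow_left' (mul_le_mul_right (sepNum_ball_antitone T (by positivity)
    (by linarith)) _) b

theorem ratio_smul_mem {E : Type*} [AddCommGroup E] [Module ℝ E] {T : Set E} (hT : Convex ℝ T)
    (h0 : (0 : E) ∈ T) {x : E} (hx : x ∈ T) {i n : ℕ} (hi : i ∈ Finset.range n) :
    ((i : ℝ) / n) • x ∈ T := by
  rw [Finset.mem_range] at hi
  have hn : (0 : ℝ) < n := by exact_mod_cast (Nat.zero_le i).trans_lt hi
  exact hT.smul_mem_of_zero_mem h0 hx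
    ⟨by positivity, (div_le_one hn).2 (by exact_mod_cast hi.le)⟩

theorem lt_abs_ratio_sub_mul {i j n : ℕ} (hij : i ≠ j) (hi : i ∈ Finset.range n) {s c : ℝ}
    (hs : 0 < s) (hc : n * s < c) : s < |(i : ℝ) / n - j / n| * c := by
  rw [Finset.mem_range] at hi
  have hn : (0 : ℝ) < n := by exact_mod_cast (Nat.zero_le i).trans_lt hi
  have h1 : (1 : ℝ) ≤ |(i : ℝ) - j| := by
    have : (1 : ℤ) ≤ |(i : ℤ) - j| := Int.one_le_abs (by omega)
    exact_mod_cast this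
  rw [← sub_div, abs_div, abs_of_pos hn, div_mul_eq_mul_div, lt_div_iff₀ hn]
  have : 0 < c := (mul_pos hn hs).trans hc
  nlinarith

/-- Arbitrarily many equally spaced points fit on a long enough segment from the origin. -/
theorem sepNum_ball_eq_top {T : Set X} (hTc : Convex ℝ T) (h0 : (0 : X) ∈ T)
    (hT : ¬ ∃ r, ∀ x ∈ T, ‖x‖ ≤ r) {s : ℝ} (hs : 0 < s) : sepNum T (closedBall 0 s) = ⊤ := by
  refine ENat.eq_top_iff_forall_ge.2 fun n => ?_
  obtain ⟨x, hx, hxn⟩ : ∃ x ∈ T, n * s < ‖x‖ := by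
    by_contra! hcon
    exact hT ⟨_, hcon⟩
  rw [← Finset.card_range n]
  refine card_le_sepNum_of_family (f := fun i => ((i : ℝ) / n) • x) (by simpa using hs.le)
    (fun i hi => ratio_smul_mem hTc h0 hx hi) fun i hi j hj hij h => ?_
  rw [mem_closedBall_zero_iff, ← sub_smul, norm_smul, Real.norm_eq_abs] at h
  linarith [lt_abs_ratio_sub_mul hij hi hs hxn]

theorem sepNum_dualPolar_eq_top {T : Set X} (hTs : ∀ x ∈ T, -x ∈ T)
    (hT : ¬ ∃ r, ∀ x ∈ T, ‖x‖ ≤ r) {s : ℝ} (hs : 0 < s) :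
    sepNum (closedBall (0 : StrongDual ℝ X) 1) (dualPolar T s) = ⊤ := by
  refine ENat.eq_top_iff_forall_ge.2 fun n => ?_
  obtain ⟨x, hx, hxn⟩ : ∃ x ∈ T, n * s < ‖x‖ := by
    by_contra! hcon
    exact hT ⟨_, hcon⟩
  obtain ⟨y, hy, hyx⟩ := exists_dual_apply_eq_norm x
  rw [← Finset.card_range n]
  refine card_le_sepNum_of_family (f := fun i => ((i : ℝ) / n) • y) (zero_mem_dualPolar _ hs.le)
    (fun i hi => ratio_smul_mem (convex_closedBall _ _) (by simp) (by simpa using hy) hi)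
    fun i hi j hj hij h => ?_
  have h1 := h x hx
  have h2 := h (-x) (hTs x hx)
  simp only [sub_apply, smul_apply, smul_eq_mul, map_neg, hyx] at h1 h2
  have h3 := lt_abs_ratio_sub_mul hij hi hs hxn
  rcases abs_cases ((i : ℝ) / n - j / n) with h4 | h4 <;> rw [h4.1] at h3 <;> linarith

theorem sepNum_ball_le_dual_pow {T : Set X} (hTc : Convex ℝ T) (hTs : ∀ x ∈ T, -x ∈ T)
    {m q : ℕ} (hm : m ≠ 0) (hq : 128 * 512 + 2 ≤ q)
    (h : HasAverageApprox X (1 / (32 * 512)) m) {s : ℝ} (hs : 0 < s) :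
    sepNum T (closedBall 0 s) ≤
      sepNum (closedBall (0 : StrongDual ℝ X) 1) (dualPolar T (s / 512)) ^ (2 * ((q + 1) * m)) := by
  by_cases hT : ∃ r, ∀ x ∈ T, ‖x‖ ≤ r
  · obtain ⟨r, hr⟩ := hT
    exact sepNum_ball_le_dual_pow_of_bounded hTc hTs hm hq h hr hs
  · rw [sepNum_dualPolar_eq_top hTs hT (by positivity), ENat.top_pow (by positivity)]
    exact le_top

theorem sepNum_dual_le_pow {T : Set X} (hTc : Convex ℝ T) (h0 : (0 : X) ∈ T)
    (hTs : ∀ x ∈ T, -x ∈ T) {m q : ℕ} (hm : m ≠ 0) (hq : 128 * 512 + 2 ≤ q)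
    (h : HasAverageApprox (StrongDual ℝ X) (1 / (32 * 512)) m) {s : ℝ} (hs : 0 < s) :
    sepNum (closedBall (0 : StrongDual ℝ X) 1) (dualPolar T s) ≤
      sepNum T (closedBall 0 (s / 512)) ^ (2 * ((q + 1) * m)) := by
  by_cases hT : ∃ r, ∀ x ∈ T, ‖x‖ ≤ r
  · obtain ⟨r, hr⟩ := hT
    exact sepNum_dual_le_pow_of_bounded hTc h0 hTs hm hq h hr hs
  · rw [sepNum_ball_eq_top hTc h0 hT (by positivity), ENat.top_pow (by positivity)]
    exact le_top

end chain

/-! ### Packing versus separation -/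

section packing

variable {E : Type*} [NormedAddCommGroup E] [NormedSpace ℝ E] {K D : Set E}

/-- If `x - y ∈ D`, the midpoint of `x` and `y` is interior to both translates, as half of `D` lies
in the interior of `D`. This needs `D` to be a neighbourhood of 0. -/
theorem packingNumber_le_sepNum (hDc : Convex ℝ D) (hD : ∀ x ∈ D, -x ∈ D) (h0 : D ∈ nhds (0 : E)) :
    packingNumber K D ≤ sepNum K D := by
  have hfin : ∀ S : Finset E, (∀ x ∈ S, x ∈ K) →
      ((S : Set E).PairwiseDisjoint fun x => interior (x +ᵥ D)) → (S.card : ℕ∞) ≤ sepNum K D := by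
    intro S hS hd
    refine card_le_sepNum hS fun x hx y hy hxy hmem => ?_
    have hhalf : ∀ d ∈ D, (1 / 2 : ℝ) • d ∈ interior D := by
      intro d hd
      have := hDc.combo_interior_self_mem_interior (mem_interior_iff_mem_nhds.2 h0) hd
        (a := 1 / 2) (b := 1 / 2) (by norm_num) (by norm_num) (by norm_num)
      simpa using this
    have hdis : Disjoint (interior (x +ᵥ D)) (interior (y +ᵥ D)) := hd hx hy hxy
    refine Set.disjoint_left.1 hdis
      (?_ : x + (1 / 2 : ℝ) • -(x - y) ∈ interior (x +ᵥ D)) ?_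
    · rw [interior_vadd]
      exact ⟨_, hhalf _ (hD _ hmem), rfl⟩
    · rw [interior_vadd]
      refine ⟨_, hhalf _ hmem, ?_⟩
      simp only [vadd_eq_add]
      module
  refine iSup_le fun S => iSup_le fun hS => iSup_le fun hd => ?_
  rcases S.finite_or_infinite with h | h
  · have := hfin h.toFinset (fun x hx => hS (h.mem_toFinset.1 hx)) (by simpa using hd)
    rwa [h.encard_eq_coe_toFinset_card]
  · rw [h.encard_eq, top_le_iff]
    refine ENat.eq_top_iff_forall_ge.2 fun n => ?_
    obtain ⟨t, ht, rfl⟩ := h.exists_subset_card_eq n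
    exact hfin t (fun x hx => hS (ht hx)) (hd.subset ht)

theorem sepNum_le_packingNumber (hDc : Convex ℝ D) (hD : ∀ x ∈ D, -x ∈ D) :
    sepNum K ((2 : ℝ) • D) ≤ packingNumber K D := by
  refine sepNum_le fun S hS hd => ?_
  rw [← Set.encard_coe_eq_coe_finsetCard]
  refine le_iSup_of_le (S : Set E) (le_iSup_of_le hS (le_iSup_of_le ?_ le_rfl))
  intro x hx y hy hxy
  refine Set.disjoint_left.2 fun z hzx hzy => hd x hx y hy hxy ?_
  obtain ⟨d, hd, rfl⟩ := interior_subset hzx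
  obtain ⟨d', hd', he⟩ := interior_subset hzy
  refine ⟨_, half_smul_add_half_smul_mem hDc hd' (hD d hd), ?_⟩
  simp only [vadd_eq_add] at he ⊢
  have : x - y = d' - d := by rw [sub_eq_sub_iff_add_eq_add, ← he, add_comm]
  rw [this]
  module

end packing

/-! ### Polars as sublevel sets -/

section polar

variable {X : Type*} [NormedAddCommGroup X] [NormedSpace ℝ X]

theorem smul_polar_eq_dualPolar {T : Set X} (hTs : ∀ x ∈ T, -x ∈ T) {s : ℝ} (hs : 0 < s) :
    s • StrongDual.polar ℝ T = dualPolar T s := by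
  ext y
  rw [Set.mem_smul_set_iff_inv_smul_mem₀ hs.ne', StrongDual.mem_polar_iff]
  have key : ∀ x, ‖(s⁻¹ • y) x‖ ≤ 1 ↔ |y x| ≤ s := by
    intro x
    rw [smul_apply, smul_eq_mul, norm_mul, Real.norm_of_nonneg (by positivity),
      inv_mul_le_iff₀ hs, mul_one, Real.norm_eq_abs]
  simp only [key]
  refine ⟨fun h x hx => (le_abs_self _).trans (h x hx), fun h x hx => abs_le'.2 ⟨h x hx, ?_⟩⟩
  simpa using h (-x) (hTs x hx)

theorem convex_dualPolar (T : Set X) (s : ℝ) : Convex ℝ (dualPolar T s) := by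
  intro y hy y' hy' a b ha hb hab x hx
  have h1 := mul_le_mul_of_nonneg_left (hy x hx) ha
  have h2 := mul_le_mul_of_nonneg_left (hy' x hx) hb
  simp only [add_apply, smul_apply, smul_eq_mul]
  calc a * y x + b * y' x ≤ a * s + b * s := add_le_add h1 h2
    _ = s := by rw [← add_mul, hab, one_mul]

theorem neg_mem_dualPolar {T : Set X} (hTs : ∀ x ∈ T, -x ∈ T) {s : ℝ} {y : StrongDual ℝ X}
    (hy : y ∈ dualPolar T s) : -y ∈ dualPolar T s := fun x hx => by simpa using hy (-x) (hTs x hx)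

theorem dualPolar_mem_nhds {T : Set X} {r : ℝ} (hr : ∀ x ∈ T, ‖x‖ ≤ r) {s : ℝ} (hs : 0 < s) :
    dualPolar T s ∈ nhds (0 : StrongDual ℝ X) := by
  refine Filter.mem_of_superset (Metric.closedBall_mem_nhds 0
    (by positivity : 0 < s / (|r| + 1))) fun y hy x hx => ?_
  rw [mem_closedBall_zero_iff] at hy
  refine (apply_le_of_norm_le hy ((hr x hx).trans (le_abs_self r))).trans ?_
  rw [div_mul_eq_mul_div, div_le_iff₀ (by positivity)]
  nlinarith [abs_nonneg r]

end polar

/-! ### Logarithms and the final assembly -/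

theorem logTwo_le_mul_of_le_pow {N M : ℕ∞} {b : ℕ} (h : N ≤ M ^ b) :
    logTwo N ≤ ((b : ℝ) : EReal) * logTwo M := by
  unfold logTwo
  rw [EReal.mul_div, EReal.coe_natCast, ← ENNReal.log_pow]
  refine EReal.div_le_div_right_of_nonneg (by exact_mod_cast (Real.log_pos one_lt_two).le) ?_
  refine ENNReal.log_monotone ?_
  exact_mod_cast ENat.toENNReal_le.2 h

theorem inv_mul_logTwo_le_of_le_pow {N M : ℕ∞} {b : ℕ} (hb : b ≠ 0) (h : N ≤ M ^ b) :
    (((b : ℝ)⁻¹ : ℝ) : EReal) * logTwo N ≤ logTwo M := by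
  have hb' : (0 : ℝ) < b := by positivity
  calc (((b : ℝ)⁻¹ : ℝ) : EReal) * logTwo N
      ≤ (((b : ℝ)⁻¹ : ℝ) : EReal) * (((b : ℝ) : EReal) * logTwo M) :=
        mul_le_mul_of_nonneg_left (logTwo_le_mul_of_le_pow h)
          (by exact_mod_cast (inv_pos.2 hb').le)
    _ = logTwo M := by
        rw [← mul_assoc, ← EReal.coe_mul, inv_mul_cancel₀ hb'.ne', EReal.coe_one, one_mul]

/-- A K-convex space and its dual have averaging approximations, with a number of terms that
depends only on a bound of the K-convexity constant. -/
theorem exists_hasAverageApprox (κ : ℝ≥0) {δ : ℝ} (hδ : 0 < δ) :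
    ∃ m : ℕ, m ≠ 0 ∧ ∀ (X : Type*) [NormedAddCommGroup X] [NormedSpace ℝ X],
      kConvexityConst X ≤ (κ : ℝ≥0∞) →
        HasAverageApprox X δ m ∧ HasAverageApprox (StrongDual ℝ X) δ m := by
  obtain ⟨k, hk⟩ := exists_nat_gt (4 * ((κ : ℝ) + 1 + 1))
  have hκ : (0 : ℝ) ≤ κ := κ.2
  have hk0 : 0 < k := by
    have : (0 : ℝ) < k := by linarith
    exact_mod_cast this
  have hle : (1 : ℝ) / 2 / (2 ^ (k ^ 2) : ℕ) ≤ 1 / 2 :=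
    div_le_self (by norm_num) (by exact_mod_cast Nat.one_le_two_pow)
  have hpos : (0 : ℝ) < 1 / 2 / (2 ^ (k ^ 2) : ℕ) := by positivity
  obtain ⟨m, hm, h⟩ := exists_sparse_approx (n := k ^ 2)
    (θ := 1 - 1 / 2 / (2 ^ (k ^ 2) : ℕ)) (by positivity) (by linarith) (by linarith) hδ
  refine ⟨m, hm, fun X _ _ hX => ?_⟩
  have hR := exists_rademacherBounded_of_kConvexityConst_le hX
  exact ⟨h X (hR.signBalanced (by linarith)), h _ (hR.dual.signBalanced hk)⟩

theorem mainTheorem4 (κ : ℝ≥0) :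
    ∃ a b : ℝ, 1 ≤ a ∧ 1 ≤ b ∧
      ∀ (X : Type*) [NormedAddCommGroup X] [NormedSpace ℝ X],
        kConvexityConst X ≤ (κ : ℝ≥0∞) →
        ∀ T : Set X, T.Nonempty → Convex ℝ T → (∀ x ∈ T, -x ∈ T) →
        ∀ ε : ℝ, 0 < ε →
          ((b⁻¹ : ℝ) : EReal) *
              logTwo (packingNumber (StrongDual.polar ℝ (Metric.closedBall (0 : X) 1))
                ((a * ε) • StrongDual.polar ℝ T)) ≤
            logTwo (packingNumber T (ε • Metric.closedBall (0 : X) 1)) ∧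
          logTwo (packingNumber T (ε • Metric.closedBall (0 : X) 1)) ≤
            (b : EReal) *
              logTwo (packingNumber (StrongDual.polar ℝ (Metric.closedBall (0 : X) 1))
                ((a⁻¹ * ε) • StrongDual.polar ℝ T)) := by
  obtain ⟨m, hm, happ⟩ := exists_hasAverageApprox κ (δ := 1 / (32 * 512)) (by norm_num)
  set q : ℕ := 128 * 512 + 2 with hq
  have hb : 2 * ((q + 1) * m) ≠ 0 := by positivity
  -- `1024 = 512 * 2`: the loss over all scales times the loss between packing and separation.
  refine ⟨1024, (2 * ((q + 1) * m) : ℕ), by norm_num,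
    by exact_mod_cast Nat.one_le_iff_ne_zero.2 hb, fun X _ _ hX T hTne hTc hTs ε hε => ?_⟩
  obtain ⟨happX, happD⟩ := happ X hX
  have h0 : (0 : X) ∈ T := by
    obtain ⟨x, hx⟩ := hTne
    have := half_smul_add_half_smul_mem hTc hx (hTs x hx)
    simpa using this
  have hpolar : StrongDual.polar ℝ (Metric.closedBall (0 : X) 1) = Metric.closedBall 0 1 := by
    simpa using NormedSpace.polar_closedBall (𝕜 := ℝ) (E := X) one_pos
  have hball : ε • Metric.closedBall (0 : X) 1 = Metric.closedBall 0 ε := by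
    rw [smul_unitClosedBall, Real.norm_of_nonneg hε.le]
  rw [hpolar, hball, smul_polar_eq_dualPolar hTs (by positivity),
    smul_polar_eq_dualPolar hTs (by positivity)]
  have hsymm : ∀ x ∈ Metric.closedBall (0 : X) ε, -x ∈ Metric.closedBall (0 : X) ε :=
    fun x hx => by simpa using hx
  constructor
  · refine inv_mul_logTwo_le_of_le_pow hb ?_
    have hlow : sepNum T (Metric.closedBall 0 (2 * ε)) ≤
        packingNumber T (Metric.closedBall 0 ε) := by
      have := sepNum_le_packingNumber (K := T) (convex_closedBall (0 : X) ε) hsymm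
      rwa [smul_closedBall _ _ hε.le, smul_zero, Real.norm_of_nonneg zero_le_two] at this
    -- For unbounded `T` the polar need not be a neighbourhood of 0, but then the packing number of
    -- `T` is infinite.
    by_cases hT : ∃ r, ∀ x ∈ T, ‖x‖ ≤ r
    · obtain ⟨r, hr⟩ := hT
      have h1 := packingNumber_le_sepNum (K := Metric.closedBall (0 : StrongDual ℝ X) 1)
        (convex_dualPolar T (1024 * ε)) (fun y hy => neg_mem_dualPolar hTs hy)
        (dualPolar_mem_nhds hr (by positivity))
      have h2 := sepNum_dual_le_pow hTc h0 hTs hm hq.ge happD (s := 1024 * ε) (by positivity)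
      rw [show 1024 * ε / 512 = 2 * ε by ring] at h2
      exact h1.trans (h2.trans (pow_le_pow_left' hlow _))
    · rw [sepNum_ball_eq_top hTc h0 hT (by positivity), top_le_iff] at hlow
      rw [hlow, ENat.top_pow hb]
      exact le_top
  · refine logTwo_le_mul_of_le_pow ?_
    have h1 := packingNumber_le_sepNum (K := T) (convex_closedBall (0 : X) ε) hsymm
      (Metric.closedBall_mem_nhds _ hε)
    have h2 := sepNum_ball_le_dual_pow hTc hTs hm hq.ge happX hε
    have h3 := sepNum_le_packingNumber (K := Metric.closedBall (0 : StrongDual ℝ X) 1)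
      (convex_dualPolar T (1024⁻¹ * ε)) (fun y hy => neg_mem_dualPolar hTs hy)
    rw [← smul_polar_eq_dualPolar hTs (by positivity), smul_smul,
      smul_polar_eq_dualPolar hTs (by positivity), smul_polar_eq_dualPolar hTs (by positivity),
      show 2 * (1024⁻¹ * ε) = ε / 512 by ring] at h3
    exact h1.trans (h2.trans (pow_le_pow_left' h3 _))
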